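/- Let $d\ge 0$, let $F$ be a Borel probability distribution on $[0,1]^d$, and let $\nu$ be a distribution on $\mathbb R$ with mean $0$ and finite positive variance. Let $X_1,X_2,\dots$ be i.i.d. with law $F$ and, independently of them, let $\epsilon_{ij}$ $(i,j\ge 1)$ be i.i.d. with law $\nu$. Let $\mu:[0,1]^d\to\mathbb R$ be continuous with $\mu\ge\tau_0$, where $\tau_0$ is known, and put $S_0=\mu^{-1}(\tau_0)$. Responses are $Y_{ij}=\mu(X_i)+\epsilon_{ij}$. For $n$ covariate levels with $m=m_n$ replicates each, let $\bar Y_{i\cdot}=m^{-1}\sum_{j=1}^m Y_{ij}$ and, with $\Phi$ the standard normal distribution function and $\gamma\in(1/2,1)$ fixed, let $$\mathbb M_n(S)=\frac1n\sum_{i=1}^n\bigl\{\Phi\bigl(\sqrt m(\bar Y_{i\cdot}-\tau_0)\bigr)-\gamma\bigr\}1_S(X_i),\qquad M_F(S)=\int_S\Bigl(\tfrac12 1_{S_0}+1_{S_0^c}-\gamma\Bigr)\,dF .$$ Let $\tilde{\mathcal S}$ be a class of Borel subsets of $[0,1]^d$ containing $S_0$, and assume that $S_0$ is the unique minimizer of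 $M_F$ over $\tilde{\mathcal S}$, up to $F$-null sets. Let $H_B(u,\tilde{\mathcal S},L_2(F))$ be the logarithm of the minimal number of brackets $[l,h]$ with $l,h\in L_2(F)$ and $\|h-l\|_{L_2(F)}\le u$ such that every $1_S$, $S\in\tilde{\mathcal S}$, satisfies $l\le 1_S\le h$ pointwise for one of them ($+\infty$ if there is no finite such collection). Write $d_F(S,T)=F(S\triangle T)$, let $\rho$ be the $\ell_\infty$ distance, and write $S^\epsilon=\{x\in[0,1]^d:\rho(x,S)<\epsilon\}$ and ${}_\epsilon S=\{x\in[0,1]^d:\rho(x,[0,1]^d\setminus S)\ge\epsilon\}$, where the distance to the empty set is $+\infty$. Probabilities of possibly non-measurable events are outer probabilities. (a) Consistency. Assume that $H_B(u,\tilde{\mathcal S},L_2(F))<\infty$ for every $u>0$. Then, for every sequence $m=m_n\to\infty$ and every choice of minimizers $\tilde S_n\in\operatorname{argmin}_{S\in\tilde{\mathcal S}}\mathbb M_n(S)$, $d_F(\tilde S_n,S_0)\to 0$ in probability. (b) Rate. Let $p>0$. Assume that there are $\kappa_0,C_0>0$ with $C_0\,\rho(x,S_0)^p\le\mu(x)-\tau_0$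 whenever $x\notin S_0$ and $\rho(x,S_0)<\kappa_0$ (a condition regarded as satisfied if $S_0=\emptyset$), that there is $\bar c>0$ with $F(S_0^\epsilon\setminus{}_\epsilon S_0)\le\bar c\,\epsilon$ for every $\epsilon>0$, and that for some $r<2$ and some constant $A$, $H_B(u,\tilde{\mathcal S},L_2(F))\le A u^{-r}$ for $0<u\le 1$. Then there is $K_1>0$ such that, for every sequence $m=m_n\to\infty$ and every choice of minimizers $\tilde S_n$, $$P\bigl(d_F(\tilde S_n,S_0)>\tilde\delta_n\bigr)\to 0,\qquad \tilde\delta_n=K_1\max\bigl(n^{-2/(2+r)},\,m^{-1/(2p)}\bigr).$$ (For $r=-2$ the first term is read as $1$; for $r<0$ the entropy assumption makes all members of $\tilde{\mathcal S}$ equal up to $F$-null sets.) -/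

import Mathlib

open MeasureTheory ProbabilityTheory Filter Topology
open scoped ENNReal symmDiff

noncomputable section

namespace BaselineSet

/-- The unit cube `[0,1]^d`; its distance (from the product structure) is the `ℓ_∞` distance. -/
abbrev Cube (d : ℕ) : Type := Fin d → unitInterval

/-- The distribution function of the standard normal law. -/
def stdNormalCDF (t : ℝ) : ℝ := cdf (gaussianReal 0 1) t

/-- The baseline set `S₀ = μ⁻¹(τ₀)`. -/
def baseline {d : ℕ} (μ : Cube d → ℝ) (τ₀ : ℝ) : Set (Cube d) := μ ⁻¹' {τ₀}

/-- The random elements of the dose-response model: the covariates `X i` are i.i.d. with law `F`,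
the errors `ε i j` are i.i.d. with law `ν`, which is centred with finite positive variance, and
the errors are independent of the covariates. -/
structure IsDoseResponseDesign {d : ℕ} {Ω : Type*} [MeasurableSpace Ω] (P : Measure Ω)
    (F : Measure (Cube d)) (ν : Measure ℝ) (X : ℕ → Ω → Cube d) (ε : ℕ → ℕ → Ω → ℝ) : Prop where
  measurable_X : ∀ i, Measurable (X i)
  measurable_err : ∀ i j, Measurable (ε i j)
  law_X : ∀ i, P.map (X i) = F
  law_err : ∀ i j, P.map (ε i j) = ν
  indep_X : iIndepFun X P
  indep_err : iIndepFun (fun k : ℕ × ℕ => ε k.1 k.2) P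
  indep_X_err : IndepFun (fun ω i => X i ω) (fun ω (k : ℕ × ℕ) => ε k.1 k.2 ω) P
  err_sq_integrable : MemLp id 2 ν
  err_mean : ∫ e, e ∂ν = 0
  err_variance_pos : 0 < variance id ν

/-- The `j`-th response at the `i`-th covariate level, `Y_{ij} = μ(X_i) + ε_{ij}`. -/
def response {d : ℕ} {Ω : Type*} (μ : Cube d → ℝ) (X : ℕ → Ω → Cube d) (ε : ℕ → ℕ → Ω → ℝ)
    (i j : ℕ) (ω : Ω) : ℝ := μ (X i ω) + ε i j ω

/-- The average of the first `m` responses at the `i`-th covariate level. -/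
def meanResponse {d : ℕ} {Ω : Type*} (μ : Cube d → ℝ) (X : ℕ → Ω → Cube d) (ε : ℕ → ℕ → Ω → ℝ)
    (m i : ℕ) (ω : Ω) : ℝ := (∑ j ∈ Finset.range m, response μ X ε i j ω) / m

open Classical in
/-- The empirical criterion
`𝕄ₙ(S) = n⁻¹ ∑_{i < n} (Φ(√m (Ȳ_i - τ₀)) - γ) 1_S(X_i)`, with `m` replicates per level. -/
def empCriterion {d : ℕ} {Ω : Type*} (μ : Cube d → ℝ) (τ₀ γ : ℝ) (X : ℕ → Ω → Cube d)
    (ε : ℕ → ℕ → Ω → ℝ) (m n : ℕ) (ω : Ω) (S : Set (Cube d)) : ℝ :=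
  (∑ i ∈ Finset.range n,
    if X i ω ∈ S then stdNormalCDF (√(m : ℝ) * (meanResponse μ X ε m i ω - τ₀)) - γ else 0) / n

/-- `Sn n ω` minimizes the empirical criterion over the class `𝒮`, for every `n` and every
outcome `ω`; no measurability of the selection is required. -/
def IsArgminEstimator {d : ℕ} {Ω : Type*} (μ : Cube d → ℝ) (τ₀ γ : ℝ) (X : ℕ → Ω → Cube d)
    (ε : ℕ → ℕ → Ω → ℝ) (m : ℕ → ℕ) (𝒮 : Set (Set (Cube d)))
    (Sn : ℕ → Ω → Set (Cube d)) : Prop :=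
  ∀ n ω, Sn n ω ∈ 𝒮 ∧ IsMinOn (empCriterion μ τ₀ γ X ε (m n) n ω) 𝒮 (Sn n ω)

open Classical in
/-- The population criterion `M_F(S) = ∫_S (½ 1_{S₀} + 1_{S₀ᶜ} - γ) dF`. -/
def popCriterion {d : ℕ} (F : Measure (Cube d)) (S₀ : Set (Cube d)) (γ : ℝ)
    (S : Set (Cube d)) : ℝ :=
  ∫ x in S, ((if x ∈ S₀ then 1 / 2 else 1) - γ) ∂F

/-- `S₀` is the unique minimizer of `M_F` over `𝒮`, up to `F`-null sets. -/
def IsUniqueMinimizer {d : ℕ} (F : Measure (Cube d)) (γ : ℝ) (𝒮 : Set (Set (Cube d)))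
    (S₀ : Set (Cube d)) : Prop :=
  IsMinOn (popCriterion F S₀ γ) 𝒮 S₀ ∧
    ∀ S ∈ 𝒮, popCriterion F S₀ γ S = popCriterion F S₀ γ S₀ → F (S ∆ S₀) = 0

/-- The distance `d_F(S, T) = F(S ∆ T)`. -/
def distF {d : ℕ} (F : Measure (Cube d)) (S T : Set (Cube d)) : ℝ := F.real (S ∆ T)

/-- `μ` is `p`-regular at the boundary of `S₀ = μ⁻¹(τ₀)`. -/
def PRegular {d : ℕ} (μ : Cube d → ℝ) (τ₀ p : ℝ) : Prop :=
  ∃ κ₀ > 0, ∃ C₀ > 0, ∀ x ∉ baseline μ τ₀, Metric.infDist x (baseline μ τ₀) < κ₀ →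
    C₀ * Metric.infDist x (baseline μ τ₀) ^ p ≤ μ x - τ₀

/-- The `δ`-thinning `{x : ρ(x, Sᶜ) ≥ δ}` of `S`; extended distances are used so that
`ρ(x, ∅) = ∞`. (The `δ`-fattening `{x : ρ(x, S) < δ}` is Mathlib's `Metric.thickening δ S`.) -/
def thinning {d : ℕ} (δ : ℝ) (S : Set (Cube d)) : Set (Cube d) :=
  {x | ENNReal.ofReal δ ≤ Metric.infEDist x Sᶜ}

/-- The class `𝒢` is covered by `k` brackets `[l, h]` of `L²(Q)`-size at most `u`. The brackets
hold at every point, not merely almost everywhere. -/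
def CoveredByBrackets {α : Type*} [MeasurableSpace α] (Q : Measure α) (𝒢 : Set (α → ℝ)) (u : ℝ)
    (k : ℕ) : Prop :=
  ∃ l h : Fin k → α → ℝ,
    (∀ i, MemLp (l i) 2 Q ∧ MemLp (h i) 2 Q ∧ eLpNorm (h i - l i) 2 Q ≤ ENNReal.ofReal u) ∧
    ∀ g ∈ 𝒢, ∃ i, ∀ x, l i x ≤ g x ∧ g x ≤ h i x

/-- The bracketing number `N_[](u, 𝒢, L²(Q))`, which is `⊤` if no finite cover exists. -/
def bracketingNumber {α : Type*} [MeasurableSpace α] (Q : Measure α) (𝒢 : Set (α → ℝ))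
    (u : ℝ) : ℕ∞ :=
  sInf {N : ℕ∞ | ∃ k : ℕ, N = k ∧ CoveredByBrackets Q 𝒢 u k}

/-- The entropy with bracketing `H_B(u, 𝒢, L²(Q)) = log N_[](u, 𝒢, L²(Q))`. -/
def bracketingEntropy {α : Type*} [MeasurableSpace α] (Q : Measure α) (𝒢 : Set (α → ℝ))
    (u : ℝ) : EReal :=
  ENNReal.log (bracketingNumber Q 𝒢 u : ℝ≥0∞)

/-- The class of indicator functions of a class of sets. -/
def indicators {α : Type*} (𝒮 : Set (Set α)) : Set (α → ℝ) :=
  (fun S => S.indicator fun _ => (1 : ℝ)) '' 𝒮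

end BaselineSet

end

/-! After centring, the weight at a level with covariate `x` is `Φ(√m (μ(x) - τ₀) + Z) - γ`, where
`Z` is a normalized sum of errors. By the central limit theorem its mean tends to `1/2 - γ < 0` on
`S₀` by symmetry, and exceeds a positive constant wherever `√m (μ(x) - τ₀) ≥ t`, for a suitable
fixed `t`. Hence, for large `m`, the mean has the right sign with a fixed margin `c`, except on
`nearBaseline`. The mass of that set tends to zero, and is `O(m^{-1/(2p)})` under the regularity and
boundary conditions.

If `L ⊆ S ⊆ U`, the criterion increment from `S₀` to `S` dominates an i.i.d. average of
`lowerIncrement`, which depends only on the bracket. Its mean is at least `c D`, and its second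
moment at most `2 D`, up to error terms, with `D = d_F(L, S₀)`. Because the second moment is linear
in `D`, Chernoff gives `exp(-const · δ n)` for every bracket with `D ≥ δ/2`, so a single union bound
replaces chaining and peeling (`measure_lt_distF_le`).

For fixed `δ` this is consistency. For `r > 0` the log-number of brackets is of order `δ^{-r/2}`,
and balancing it against `δ n` gives `n^{-2/(2+r)}`. For `r ≤ 0` the bracketing numbers are bounded,
so `d_F(·, S₀)` takes finitely many values on the class and consistency already forces distance zero
with probability tending to one. -/

namespace BaselineSet

/-! ### The normal distribution function. -/

theorem monotone_stdNormalCDF : Monotone stdNormalCDF := monotone_cdf _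

theorem stdNormalCDF_nonneg (t : ℝ) : 0 ≤ stdNormalCDF t := cdf_nonneg _ _

theorem stdNormalCDF_le_one (t : ℝ) : stdNormalCDF t ≤ 1 := cdf_le_one _ _

theorem stdNormalCDF_eq_real (t : ℝ) :
    stdNormalCDF t = (gaussianReal 0 1).real (Set.Iic t) := cdf_eq_real _ _

theorem stdNormalCDF_neg (t : ℝ) : stdNormalCDF (-t) = 1 - stdNormalCDF t := by
  have h := gaussianReal_map_neg (μ := 0) (v := 1)
  rw [neg_zero] at h
  have hne : NullSingletonClass (gaussianReal 0 1) := nullSingletonClass_gaussianReal (by simp)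
  rw [stdNormalCDF_eq_real, stdNormalCDF_eq_real, ← probReal_compl_eq_one_sub measurableSet_Iic]
  conv_lhs => rw [← h, map_measureReal_apply (by fun_prop) measurableSet_Iic]
  have h1 : (fun x : ℝ => -x) ⁻¹' Set.Iic (-t) = Set.Ici t := by ext; simp
  rw [h1, Set.compl_Iic]
  exact (measureReal_congr Ioi_ae_eq_Ici).symm

theorem tendsto_stdNormalCDF_atTop : Tendsto stdNormalCDF atTop (𝓝 1) := tendsto_cdf_atTop _

theorem continuous_stdNormalCDF : Continuous stdNormalCDF := by
  have hne : NullSingletonClass (gaussianReal 0 1) := nullSingletonClass_gaussianReal (by simp)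
  rw [continuous_iff_continuousAt]
  intro x
  -- The jump at `x` is the mass of `{x}`, which vanishes; this gives left continuity.
  have h := (cdf (gaussianReal 0 1)).measure_singleton x
  rw [measure_cdf, measure_singleton, eq_comm, ENNReal.ofReal_eq_zero, sub_nonpos] at h
  refine continuousAt_iff_continuous_left'_right'.2 ⟨?_, ?_⟩
  · rw [ContinuousWithinAt]
    have h2 := (monotone_cdf (gaussianReal 0 1)).tendsto_leftLim x
    rwa [le_antisymm ((monotone_cdf (gaussianReal 0 1)).leftLim_le le_rfl) h] at h2
  · exact ((cdf (gaussianReal 0 1)).right_continuous x).mono Set.Ioi_subset_Ici_self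

theorem measurable_stdNormalCDF : Measurable stdNormalCDF := continuous_stdNormalCDF.measurable

theorem integrable_of_measurable_of_mem_Icc {α : Type*} [MeasurableSpace α] {Q : Measure α}
    [IsFiniteMeasure Q] {f : α → ℝ} (hf : Measurable f) (a b : ℝ) (h : ∀ x, f x ∈ Set.Icc a b) :
    Integrable f Q :=
  Integrable.of_mem_Icc a b hf.aemeasurable (ae_of_all _ h)

theorem integrable_stdNormalCDF_add (Q : Measure ℝ) [IsFiniteMeasure Q] (s : ℝ) :
    Integrable (fun z => stdNormalCDF (s + z)) Q :=
  integrable_of_measurable_of_mem_Icc (measurable_stdNormalCDF.comp (by fun_prop)) 0 1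
    fun _ => ⟨stdNormalCDF_nonneg _, stdNormalCDF_le_one _⟩

/-- Reflecting `z` and using `Φ(-z) = 1 - Φ(z)` shows that the integral `I` satisfies `I = 1 - I`,
whatever the variance. -/
theorem integral_stdNormalCDF_gaussianReal (v : NNReal) :
    ∫ z, stdNormalCDF z ∂(gaussianReal 0 v) = 1 / 2 := by
  have hi : Integrable stdNormalCDF (gaussianReal 0 v) := by
    simpa using integrable_stdNormalCDF_add (gaussianReal 0 v) 0
  have h := gaussianReal_map_neg (μ := 0) (v := v)
  rw [neg_zero] at h
  have h2 : ∫ z, stdNormalCDF z ∂(gaussianReal 0 v)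
      = ∫ z, (1 - stdNormalCDF z) ∂(gaussianReal 0 v) := by
    conv_lhs => rw [← h]
    rw [integral_map (by fun_prop) continuous_stdNormalCDF.aestronglyMeasurable]
    simp_rw [stdNormalCDF_neg]
  rw [integral_sub (integrable_const _) hi] at h2
  simp at h2
  linarith

/-! ### Mean weights and their limits as the number of replicates grows. -/

/-- The standardized average `m^{-1/2} ∑_{j < m} ε_{ij}` of the errors at the `i`-th level. -/
noncomputable def scaledError {Ω : Type*} (ε : ℕ → ℕ → Ω → ℝ) (m i : ℕ) (ω : Ω) : ℝ :=
  (√(m : ℝ))⁻¹ * ∑ j ∈ Finset.range m, ε i j ω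

/-- The expectation of `Φ(s + Z)` for `Z` with law `ζ`. -/
noncomputable def smoothedCDF (ζ : Measure ℝ) (s : ℝ) : ℝ := ∫ z, stdNormalCDF (s + z) ∂ζ

theorem monotone_smoothedCDF (ζ : Measure ℝ) [IsFiniteMeasure ζ] : Monotone (smoothedCDF ζ) :=
  fun s t hst => integral_mono (integrable_stdNormalCDF_add ζ s) (integrable_stdNormalCDF_add ζ t)
    fun z => monotone_stdNormalCDF (by linarith)

theorem tendsto_smoothedCDF_atTop (ζ : Measure ℝ) [IsProbabilityMeasure ζ] :
    Tendsto (smoothedCDF ζ) atTop (𝓝 1) := by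
  have h : Tendsto (smoothedCDF ζ) atTop (𝓝 (∫ _, (1 : ℝ) ∂ζ)) := by
    refine tendsto_integral_filter_of_dominated_convergence (fun _ => (1 : ℝ)) ?_ ?_
      (integrable_const _) ?_
    · exact Eventually.of_forall fun s => (integrable_stdNormalCDF_add ζ s).aestronglyMeasurable
    · refine Eventually.of_forall fun s => ae_of_all _ fun z => ?_
      rw [Real.norm_of_nonneg (stdNormalCDF_nonneg _)]
      exact stdNormalCDF_le_one _
    · refine ae_of_all _ fun z => tendsto_stdNormalCDF_atTop.comp ?_
      exact tendsto_atTop_add_const_right _ _ tendsto_id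
  simpa using h

section Design

variable {d : ℕ} {Ω : Type*} [MeasurableSpace Ω] {P : Measure Ω}
  {F : Measure (Cube d)} {ν : Measure ℝ} {X : ℕ → Ω → Cube d} {ε : ℕ → ℕ → Ω → ℝ}

theorem IsDoseResponseDesign.measurable_scaledError (h : IsDoseResponseDesign P F ν X ε)
    (m i : ℕ) : Measurable (scaledError ε m i) :=
  (Finset.measurable_sum _ fun j _ => h.measurable_err i j).const_mul _

/-- This is the central limit theorem tested on the bounded continuous function `z ↦ Φ(s + z)`. -/
theorem IsDoseResponseDesign.tendsto_smoothedCDF [IsProbabilityMeasure P]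
    (h : IsDoseResponseDesign P F ν X ε) (s : ℝ) :
    Tendsto (fun m => smoothedCDF (P.map (scaledError ε m 0)) s) atTop
      (𝓝 (smoothedCDF (gaussianReal 0 (variance id ν).toNNReal) s)) := by
  have hlaw : ∀ j, HasLaw (ε 0 j) ν P := fun j => ⟨(h.measurable_err 0 j).aemeasurable, h.law_err 0 j⟩
  have hvar : variance (ε 0 0) P = variance id ν := (hlaw 0).variance_eq
  have hint : ∫ ω, ε 0 0 ω ∂P = 0 := by
    rw [(hlaw 0).integral_eq]; exact h.err_mean
  have hmem : MemLp (ε 0 0) 2 P := by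
    have := h.err_sq_integrable
    rw [← h.law_err 0 0] at this
    exact this.comp_of_map (h.measurable_err 0 0).aemeasurable
  have hind : iIndepFun (fun j => ε 0 j) P :=
    h.indep_err.precomp (g := fun j : ℕ => ((0 : ℕ), j)) (fun _ _ hij => by simpa using hij)
  have hY : HasLaw (id : ℝ → ℝ) (gaussianReal 0 (variance (ε 0 0) P).toNNReal)
      (gaussianReal 0 (variance id ν).toNNReal) := by
    rw [hvar]; exact HasLaw.id
  have hclt := tendstoInDistribution_inv_sqrt_mul_sum_sub hY hmem hind
    (fun j => ⟨(h.measurable_err 0 j).aemeasurable, (h.measurable_err 0 0).aemeasurable, by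
      rw [h.law_err, h.law_err]⟩)
  have h2 := hclt.tendsto
  let f : BoundedContinuousFunction ℝ ℝ := BoundedContinuousFunction.ofNormedAddCommGroup
    (fun z => stdNormalCDF (s + z)) (continuous_stdNormalCDF.comp (by fun_prop)) 1 (fun z => by
      rw [Real.norm_of_nonneg (stdNormalCDF_nonneg _)]
      exact stdNormalCDF_le_one _)
  have h3 := ProbabilityMeasure.tendsto_iff_forall_integral_tendsto.1 h2 f
  simp only [ProbabilityMeasure.coe_mk, Measure.map_id, hint, mul_zero, sub_zero] at h3
  exact h3

/-- The margin by which the limiting weights `1/2` and `1` are separated from `γ`. -/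
noncomputable def margin (γ : ℝ) : ℝ := min (γ - 1 / 2) (1 - γ) / 2

theorem margin_pos {γ : ℝ} (h₁ : 1 / 2 < γ) (h₂ : γ < 1) : 0 < margin γ := by
  have : 0 < min (γ - 1 / 2) (1 - γ) := lt_min (by linarith) (by linarith)
  unfold margin; linarith

theorem margin_le (γ : ℝ) : margin γ ≤ 1 / 8 := by
  have h1 := min_le_left (γ - 1 / 2) (1 - γ)
  have h2 := min_le_right (γ - 1 / 2) (1 - γ)
  unfold margin; linarith

/-- For many replicates, the mean weight is separated from `γ`: below on the baseline set, above
wherever the scaled regression function exceeds a constant. -/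
theorem IsDoseResponseDesign.exists_smoothedCDF_separated [IsProbabilityMeasure P]
    (h : IsDoseResponseDesign P F ν X ε) {γ : ℝ} (h₁ : 1 / 2 < γ) (h₂ : γ < 1) :
    ∃ t : ℝ, ∀ᶠ m in atTop, smoothedCDF (P.map (scaledError ε m 0)) 0 ≤ γ - margin γ ∧
      γ + margin γ ≤ smoothedCDF (P.map (scaledError ε m 0)) t := by
  have h3 := min_le_left (γ - 1 / 2) (1 - γ)
  have h4 := min_le_right (γ - 1 / 2) (1 - γ)
  have hpos := margin_pos h₁ h₂
  set G := gaussianReal 0 (variance id ν).toNNReal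
  obtain ⟨t, ht⟩ := ((tendsto_smoothedCDF_atTop G).eventually_const_lt
    (show γ + margin γ < 1 by unfold margin; linarith)).exists
  refine ⟨t, ?_⟩
  have h0 : smoothedCDF G 0 < γ - margin γ := by
    have : smoothedCDF G 0 = 1 / 2 := by
      simpa [smoothedCDF] using integral_stdNormalCDF_gaussianReal (variance id ν).toNNReal
    rw [this]; unfold margin; linarith
  filter_upwards [(h.tendsto_smoothedCDF 0).eventually_lt_const h0,
    (h.tendsto_smoothedCDF t).eventually_const_lt ht] with m hm1 hm2
  exact ⟨hm1.le, hm2.le⟩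

end Design

/-! ### From functional brackets to brackets of sets. -/

/-- The class `𝒮` is covered by `k` brackets `L ⊆ S ⊆ U` of measurable sets with
`Q (U \ L) ≤ a`. -/
def CoveredBySetBrackets {α : Type*} [MeasurableSpace α] (Q : Measure α) (𝒮 : Set (Set α))
    (a : ℝ) (k : ℕ) : Prop :=
  ∃ L U : Fin k → Set α,
    (∀ i, MeasurableSet (L i) ∧ MeasurableSet (U i) ∧ Q.real (U i \ L i) ≤ a) ∧
    ∀ S ∈ 𝒮, ∃ i, L i ⊆ S ∧ S ⊆ U i

section Brackets

variable {α : Type*} [MeasurableSpace α] {Q : Measure α} {𝒮 : Set (Set α)}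

/-- Functional brackets for indicators can be replaced by brackets of measurable sets. -/
theorem CoveredByBrackets.coveredBySetBrackets {u : ℝ} (hu : 0 ≤ u) {k : ℕ}
    (h : CoveredByBrackets Q (indicators 𝒮) u k) : CoveredBySetBrackets Q 𝒮 (u ^ 2) k := by
  obtain ⟨l, h, hlh, hcov⟩ := h
  -- Indicators take only the values 0 and 1, so `l > 0` forces membership in `S` and membership
  -- forces `h ≥ 1`. On `{h ≥ 1} \ {l > 0}` the gap `h - l` is at least 1, and Chebyshev bounds its
  -- mass by `u²`.
  have hL0 : ∀ i, NullMeasurableSet {x | 0 < l i x} Q := fun i =>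
    nullMeasurableSet_lt aemeasurable_const (hlh i).1.aestronglyMeasurable.aemeasurable
  have hU0 : ∀ i, NullMeasurableSet {x | 1 ≤ h i x} Q := fun i =>
    nullMeasurableSet_le aemeasurable_const (hlh i).2.1.aestronglyMeasurable.aemeasurable
  -- Measurable versions are taken from inside for `L` and from outside for `U`, which keeps the
  -- inclusions pointwise.
  choose L hLsub hLm hLae using fun i => (hL0 i).exists_measurable_subset_ae_eq
  choose U hUsub hUm hUae using fun i => (hU0 i).exists_measurable_superset_ae_eq
  refine ⟨L, U, fun i => ⟨hLm i, hUm i, ?_⟩, fun S hS => ?_⟩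
  · rw [measureReal_congr ((hUae i).diff (hLae i))]
    refine ENNReal.toReal_le_of_le_ofReal (by positivity) ?_
    calc Q ({x | 1 ≤ h i x} \ {x | 0 < l i x})
        ≤ Q {x | 1 ≤ ‖(h i - l i) x‖ₑ} := by
          refine measure_mono fun x hx => ?_
          obtain ⟨h1, h2⟩ := hx
          simp only [Set.mem_ofPred_eq, not_lt, Pi.sub_apply] at h1 h2 ⊢
          rw [Real.enorm_eq_ofReal_abs, ← ENNReal.ofReal_one]
          exact ENNReal.ofReal_le_ofReal ((by linarith : 1 ≤ h i x - l i x).trans (le_abs_self _))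
      _ ≤ eLpNorm (h i - l i) 2 Q ^ (2 : ℝ) := by
          have := meas_ge_le_mul_pow_eLpNorm_enorm Q (p := 2) (by simp) (by simp)
            ((hlh i).2.1.sub (hlh i).1).aestronglyMeasurable (ε := 1) (by simp) (by simp)
          simpa using this
      _ ≤ ENNReal.ofReal u ^ (2 : ℝ) := by gcongr; exact (hlh i).2.2
      _ = ENNReal.ofReal (u ^ 2) := by
          rw [ENNReal.ofReal_rpow_of_nonneg hu (by norm_num), Real.rpow_two]
  · obtain ⟨i, hi⟩ := hcov _ ⟨S, hS, rfl⟩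
    refine ⟨i, fun x hx => ?_, fun x hx => hUsub i ?_⟩
    · by_contra hxS
      have h1 := (hi x).1
      have h2 : 0 < l i x := hLsub i hx
      simp [hxS] at h1
      linarith
    · have h1 := (hi x).2
      simpa [hx] using h1

theorem exists_coveredByBrackets_of_bracketingNumber_ne_top {𝒢 : Set (α → ℝ)} {u : ℝ}
    (h : bracketingNumber Q 𝒢 u ≠ ⊤) :
    ∃ k : ℕ, bracketingNumber Q 𝒢 u = k ∧ CoveredByBrackets Q 𝒢 u k := by
  have hne : {N : ℕ∞ | ∃ k : ℕ, N = k ∧ CoveredByBrackets Q 𝒢 u k}.Nonempty := by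
    by_contra hne
    rw [Set.not_nonempty_iff_eq_empty] at hne
    exact h (by rw [bracketingNumber, hne, sInf_empty])
  exact csInf_mem hne

theorem exists_coveredBySetBrackets_of_entropy_lt_top {a : ℝ} (ha : 0 ≤ a)
    (h : bracketingEntropy Q (indicators 𝒮) (√a) < ⊤) :
    ∃ k, CoveredBySetBrackets Q 𝒮 a k := by
  rw [bracketingEntropy, ENNReal.log_lt_top_iff] at h
  obtain ⟨k, -, hk⟩ := exists_coveredByBrackets_of_bracketingNumber_ne_top (by simpa using h.ne)
  have := hk.coveredBySetBrackets (Real.sqrt_nonneg a)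
  rw [Real.sq_sqrt ha] at this
  exact ⟨k, this⟩

theorem exists_coveredBySetBrackets_of_entropy_le {a x : ℝ} (ha : 0 ≤ a)
    (h : bracketingEntropy Q (indicators 𝒮) (√a) ≤ (x : EReal)) :
    ∃ k : ℕ, (k : ℝ) ≤ Real.exp x ∧ CoveredBySetBrackets Q 𝒮 a k := by
  have hlt := h.trans_lt (EReal.coe_lt_top x)
  rw [bracketingEntropy, ENNReal.log_lt_top_iff] at hlt
  obtain ⟨k, hk, hcov⟩ :=
    exists_coveredByBrackets_of_bracketingNumber_ne_top (by simpa using hlt.ne)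
  have hcov' := hcov.coveredBySetBrackets (Real.sqrt_nonneg a)
  rw [Real.sq_sqrt ha] at hcov'
  refine ⟨k, ?_, hcov'⟩
  rcases Nat.eq_zero_or_pos k with rfl | hk0
  · simpa using (Real.exp_pos x).le
  have hk0' : (0 : ℝ) < k := by exact_mod_cast hk0
  rw [bracketingEntropy, hk] at h
  have h2 : (((k : ℕ) : ℕ∞) : ℝ≥0∞) = ENNReal.ofReal (k : ℝ) := by simp
  rw [h2, ENNReal.log_ofReal_of_pos hk0', EReal.coe_le_coe_iff] at h
  exact (Real.log_le_iff_le_exp hk0').1 h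

end Brackets

/-! ### Classes with bounded bracketing numbers. -/

section FiniteValues

variable {d : ℕ} {F : Measure (Cube d)}

theorem distF_le_add_of_subset [IsFiniteMeasure F] {S T L U : Set (Cube d)} (S₀ : Set (Cube d))
    (hS : S ⊆ U) (hS' : L ⊆ S) (hT : T ⊆ U) (hT' : L ⊆ T) :
    distF F S S₀ ≤ distF F T S₀ + F.real (U \ L) := by
  refine (measureReal_mono ?_).trans (measureReal_union_le _ _)
  intro x hx
  have h1 := @hS x
  have h2 := @hS' x
  have h3 := @hT x
  have h4 := @hT' x
  simp only [Set.mem_symmDiff, Set.mem_union, Set.mem_sdiff] at hx ⊢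
  tauto

/-- If the bracketing numbers are bounded as the bracket size tends to zero, then the distances
to a fixed set take only finitely many values. -/
theorem finite_distF_image [IsFiniteMeasure F] {𝒮 : Set (Set (Cube d))} (S₀ : Set (Cube d)) {N : ℕ}
    (h : ∀ a : ℝ, 0 < a → a ≤ 1 → ∃ k ≤ N, CoveredBySetBrackets F 𝒮 a k) :
    ((fun S => distF F S S₀) '' 𝒮).Finite := by
  by_contra hinf
  obtain ⟨V, hV, hcard⟩ := Set.Infinite.exists_subset_card_eq hinf (N + 1)
  have hev : ∀ᶠ a in 𝓝[>] (0 : ℝ), ∀ v ∈ V, ∀ w ∈ V, v ≠ w → a < |v - w| := by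
    simp only [Filter.eventually_all_finset]
    intro v _ w _
    rw [Filter.eventually_imp_distrib_left]
    intro hvw
    exact (eventually_lt_nhds (abs_pos.2 (sub_ne_zero.2 hvw))).filter_mono nhdsWithin_le_nhds
  have hev1 : ∀ᶠ a in 𝓝[>] (0 : ℝ), a ≤ 1 :=
    (eventually_le_nhds one_pos).filter_mono nhdsWithin_le_nhds
  -- The size `a` is below every gap among `N + 1` distinct values; by pigeonhole two of the
  -- corresponding sets share a bracket, so their values differ by at most `a`.
  obtain ⟨a, ha, ha1, ha0⟩ := (hev.and (hev1.and self_mem_nhdsWithin)).exists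
  obtain ⟨k, hkN, L, U, hLU, hcov⟩ := h a ha0 ha1
  choose S hS hSv using fun v : V => hV v.2
  choose i hi using fun v : V => hcov (S v) (hS v)
  obtain ⟨v, w, hvw, hiv⟩ := Fintype.exists_ne_map_eq_of_card_lt i (by
    simp only [Fintype.card_fin, Fintype.card_coe, hcard]; omega)
  have hgap := ha v v.2 w w.2 (Subtype.coe_injective.ne hvw)
  have hv := hi v
  have hw := hi w
  rw [← hiv] at hw
  have h1 := distF_le_add_of_subset (F := F) S₀ hv.2 hv.1 hw.2 hw.1
  have h2 := distF_le_add_of_subset (F := F) S₀ hw.2 hw.1 hv.2 hv.1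
  have h3 := (hLU (i v)).2.2
  have h4 := hSv v
  have h5 := hSv w
  simp only at h4 h5
  rw [h4, h5] at h1 h2
  have : |(v : ℝ) - w| ≤ a := abs_le.2 ⟨by linarith, by linarith⟩
  linarith

/-- Zero is isolated among the distances, so consistency at level `η` yields exact agreement up to
null sets. -/
theorem exists_pos_le_distF_of_finite {𝒮 : Set (Set (Cube d))} {S₀ : Set (Cube d)}
    (h : ((fun S => distF F S S₀) '' 𝒮).Finite) :
    ∃ η > 0, ∀ S ∈ 𝒮, 0 < distF F S S₀ → η < distF F S S₀ := by
  have hev : ∀ᶠ η in 𝓝[>] (0 : ℝ), ∀ v ∈ (fun S => distF F S S₀) '' 𝒮, 0 < v → η < v := by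
    rw [Filter.eventually_all_finite h]
    intro v _
    rw [Filter.eventually_imp_distrib_left]
    intro hv
    exact (eventually_lt_nhds hv).filter_mono nhdsWithin_le_nhds
  obtain ⟨η, hη, hη0⟩ := (hev.and self_mem_nhdsWithin).exists
  exact ⟨η, hη0, fun S hS h0 => hη _ ⟨S, hS, rfl⟩ h0⟩

end FiniteValues

end BaselineSet

/-! ### Independence of grouped families and a Chernoff bound. -/

section Independence

variable {Ω : Type*} [MeasurableSpace Ω] {P : Measure Ω} {ι κ : Type*}

/-- A jointly independent doubly indexed family, grouped by its first index, consists of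
independent sequences. -/
theorem ProbabilityTheory.iIndepFun.curry [IsProbabilityMeasure P] {β : Type*} [MeasurableSpace β]
    {Y : ι → κ → Ω → β} (mY : ∀ i j, Measurable (Y i j))
    (h : iIndepFun (fun p : ι × κ => Y p.1 p.2) P) :
    iIndepFun (fun i ω j => Y i j ω) P := by
  have hp : ∀ i j, IsProbabilityMeasure (P.map (Y i j)) :=
    fun i j => Measure.isProbabilityMeasure_map (mY i j).aemeasurable
  have hs : iIndepFun (fun p : (_ : ι) × κ => Y p.1 p.2) P :=
    h.precomp (Equiv.sigmaEquivProd ι κ).injective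
  have hrow : ∀ i, iIndepFun (fun j => Y i j) P := fun i =>
    h.precomp (g := fun j : κ => (i, j)) (fun _ _ hij => by simpa using hij)
  -- Independence means that the joint law is a product; currying the index turns a product over
  -- pairs into a product of row products.
  rw [iIndepFun_iff_map_fun_eq_infinitePi_map (fun i => measurable_pi_lambda _ fun j => mY i j)]
  have h1 := (iIndepFun_iff_map_fun_eq_infinitePi_map (P := P)
    (X := fun p : (_ : ι) × κ => Y p.1 p.2) (fun p => mY _ _)).1 hs
  have h2 : (fun ω i j => Y i j ω) =
      (MeasurableEquiv.piCurry fun (_ : ι) (_ : κ) => β) ∘ fun ω p => Y p.1 p.2 ω := by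
    ext; simp [Sigma.curry]
  rw [h2, ← Measure.map_map (by fun_prop) (measurable_pi_lambda _ fun p => mY _ _), h1,
    Measure.infinitePi_map_piCurry (fun i j => P.map (Y i j))]
  congr 1
  funext i
  exact ((iIndepFun_iff_map_fun_eq_infinitePi_map (mY i)).1 (hrow i)).symm

/-- If two independent families each have independent members, then so has the family of pairs. -/
theorem ProbabilityTheory.iIndepFun.prodMk_of_indepFun {β γ : Type*} [MeasurableSpace β]
    [MeasurableSpace γ] {X : ι → Ω → β} {Z : ι → Ω → γ} (mX : ∀ i, Measurable (X i))
    (mZ : ∀ i, Measurable (Z i)) (hX : iIndepFun X P) (hZ : iIndepFun Z P)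
    (hXZ : IndepFun (fun ω i => X i ω) (fun ω i => Z i ω) P) :
    iIndepFun (fun i ω => (X i ω, Z i ω)) P := by
  have hpair : ∀ (s : Finset ι) (A : ι → Set β) (B : ι → Set γ),
      (∀ i ∈ s, MeasurableSet (A i)) → (∀ i ∈ s, MeasurableSet (B i)) →
      P ((⋂ i ∈ s, X i ⁻¹' A i) ∩ ⋂ i ∈ s, Z i ⁻¹' B i) =
        P (⋂ i ∈ s, X i ⁻¹' A i) * P (⋂ i ∈ s, Z i ⁻¹' B i) := by
    intro s A B hA hB
    have h := hXZ.measure_inter_preimage_eq_mul (⋂ i ∈ s, {x | x i ∈ A i})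
      (⋂ i ∈ s, {z | z i ∈ B i})
      (Finset.measurableSet_biInter _ fun i hi => measurable_pi_apply i (hA i hi))
      (Finset.measurableSet_biInter _ fun i hi => measurable_pi_apply i (hB i hi))
    simp only [Set.preimage_iInter] at h
    exact h
  rw [iIndepFun_iff_iIndep]
  refine iIndepSets.iIndep (fun i => ((mX i).prodMk (mZ i)).comap_le)
    (fun i => Set.preimage (fun ω => (X i ω, Z i ω)) ''
      Set.image2 (· ×ˢ ·) {s : Set β | MeasurableSet s} {t : Set γ | MeasurableSet t})
    (fun i => isPiSystem_prod.comap _) (fun i => ?_) ?_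
  · rw [← generateFrom_prod, MeasurableSpace.comap_generateFrom]
  · rw [iIndepSets_iff]
    intro s f hf
    have hf' : ∀ i, ∃ A : Set β, ∃ B : Set γ, i ∈ s →
        MeasurableSet A ∧ MeasurableSet B ∧ f i = X i ⁻¹' A ∩ Z i ⁻¹' B := by
      intro i
      by_cases hi : i ∈ s
      · obtain ⟨_, ⟨A, hA, B, hB, rfl⟩, hfi⟩ := hf i hi
        exact ⟨A, B, fun _ => ⟨hA, hB, hfi.symm⟩⟩
      · exact ⟨∅, ∅, fun h => absurd h hi⟩
    choose A B hAB using hf'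
    have hA := fun i hi => (hAB i hi).1
    have hB := fun i hi => (hAB i hi).2.1
    have h1 : (⋂ i ∈ s, f i) = (⋂ i ∈ s, X i ⁻¹' A i) ∩ ⋂ i ∈ s, Z i ⁻¹' B i := by
      simp_rw [← Set.iInter_inter_distrib]
      exact Set.iInter₂_congr fun i hi => (hAB i hi).2.2
    rw [h1, hpair s A B hA hB, hX.measure_inter_preimage_eq_mul s hA,
      hZ.measure_inter_preimage_eq_mul s hB, ← Finset.prod_mul_distrib]
    refine Finset.prod_congr rfl fun i hi => ?_
    -- The singleton case factors each single probability, which matches the two products term by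
    -- term.
    have h2 := hpair {i} A B (by simpa using hA i hi) (by simpa using hB i hi)
    simp only [Finset.mem_singleton, Set.iInter_iInter_eq_left] at h2
    rw [(hAB i hi).2.2, h2]

/-- A Chernoff bound for the lower tail of a sum of bounded i.i.d. random variables in terms of
their first two moments. -/
theorem measureReal_sum_nonpos_le_exp [IsProbabilityMeasure P] {β : Type*} [MeasurableSpace β]
    {Q : Measure β} {V : ℕ → Ω → β} (mV : ∀ i, Measurable (V i)) (hV : iIndepFun V P)
    (hlaw : ∀ i, P.map (V i) = Q) {ξ : β → ℝ} (mξ : Measurable ξ) {M : ℝ}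
    (hξ : ∀ v, |ξ v| ≤ M) {l κ : ℝ} (hl : 0 ≤ l) (hlM : l * M ≤ 1)
    (hκ : 1 - l * ∫ v, ξ v ∂Q + l ^ 2 * ∫ v, ξ v ^ 2 ∂Q ≤ Real.exp (-κ)) (n : ℕ) :
    P.real {ω | ∑ i ∈ Finset.range n, ξ (V i ω) ≤ 0} ≤ Real.exp (-(κ * n)) := by
  have hQ : IsProbabilityMeasure Q := by
    rw [← hlaw 0]; exact Measure.isProbabilityMeasure_map (mV 0).aemeasurable
  have habs : ∀ v, |-l * ξ v| ≤ 1 := fun v => by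
    rw [abs_mul, abs_neg, abs_of_nonneg hl]
    exact (mul_le_mul_of_nonneg_left (hξ v) hl).trans hlM
  have iξ : Integrable ξ Q := Integrable.of_mem_Icc (-M) M mξ.aemeasurable
    (ae_of_all _ fun v => abs_le.1 (hξ v))
  have iξ2 : Integrable (fun v => ξ v ^ 2) Q := Integrable.of_mem_Icc 0 (M ^ 2)
    (mξ.pow_const 2).aemeasurable
    (ae_of_all _ fun v => ⟨sq_nonneg _, sq_le_sq' (abs_le.1 (hξ v)).1 (abs_le.1 (hξ v)).2⟩)
  have hmgf : ∀ i, mgf (fun ω => ξ (V i ω)) P (-l) ≤ Real.exp (-κ) := fun i => by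
    have h1 : mgf (fun ω => ξ (V i ω)) P (-l) = ∫ v, Real.exp (-l * ξ v) ∂Q := by
      rw [mgf, ← hlaw i, integral_map (mV i).aemeasurable
        (by fun_prop : Measurable fun v => Real.exp (-l * ξ v)).aestronglyMeasurable]
    rw [h1]
    refine le_trans ?_ hκ
    have i1 : Integrable (fun v => 1 - l * ξ v) Q := (integrable_const _).sub (iξ.const_mul _)
    have i2 : Integrable (fun v => l ^ 2 * ξ v ^ 2) Q := iξ2.const_mul _
    have h2 : 1 - l * ∫ v, ξ v ∂Q + l ^ 2 * ∫ v, ξ v ^ 2 ∂Q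
        = ∫ v, (1 - l * ξ v + l ^ 2 * ξ v ^ 2) ∂Q := by
      rw [integral_add i1 i2,
        integral_sub (integrable_const _) (iξ.const_mul _), integral_const_mul, integral_const_mul]
      simp
    rw [h2]
    refine integral_mono_of_nonneg (ae_of_all _ fun v => (Real.exp_pos _).le)
      (i1.add i2) (ae_of_all _ fun v => ?_)
    -- The integrand is bounded through `e^x ≤ 1 + x + x²` for `|x| ≤ 1`.
    have h3 := (abs_le.1 (Real.abs_exp_sub_one_sub_id_le (habs v))).2
    have h4 : (-l * ξ v) ^ 2 = l ^ 2 * ξ v ^ 2 := by ring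
    simp only
    linarith
  have hsum : Measurable (fun ω => ∑ i ∈ Finset.range n, ξ (V i ω)) :=
    Finset.measurable_sum _ fun i _ => mξ.comp (mV i)
  have hint : Integrable (fun ω => Real.exp (-l * ∑ i ∈ Finset.range n, ξ (V i ω))) P := by
    refine Integrable.of_mem_Icc 0 (Real.exp n) (by fun_prop) (ae_of_all _ fun ω =>
      ⟨(Real.exp_pos _).le, Real.exp_le_exp.2 ?_⟩)
    rw [Finset.mul_sum]
    calc ∑ i ∈ Finset.range n, -l * ξ (V i ω) ≤ ∑ i ∈ Finset.range n, (1 : ℝ) :=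
          Finset.sum_le_sum fun i _ => (abs_le.1 (habs _)).2
      _ = n := by simp
  have hch := measure_le_le_exp_mul_mgf (μ := P) 0 (neg_nonpos.2 hl) hint
  rw [mul_zero, Real.exp_zero, one_mul] at hch
  refine hch.trans ?_
  have hind : iIndepFun (fun i ω => ξ (V i ω)) P := hV.comp (fun _ => ξ) (fun _ => mξ)
  have hprod := hind.mgf_sum (t := -l) (fun i => mξ.comp (mV i)) (Finset.range n)
  have heq : (∑ i ∈ Finset.range n, fun ω => ξ (V i ω)) =
      fun ω => ∑ i ∈ Finset.range n, ξ (V i ω) := by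
    ext ω; simp
  rw [heq] at hprod
  rw [hprod]
  calc ∏ i ∈ Finset.range n, mgf (fun ω => ξ (V i ω)) P (-l)
      ≤ ∏ i ∈ Finset.range n, Real.exp (-κ) :=
        Finset.prod_le_prod (fun i _ => mgf_nonneg) fun i _ => hmgf i
    _ = Real.exp (-(κ * n)) := by
        rw [Finset.prod_const, Finset.card_range, ← Real.exp_nat_mul]
        ring_nf

end Independence

/-! ### Joint law of the pairs formed by a covariate and a standardized error. -/

namespace BaselineSet

section Design

variable {d : ℕ} {Ω : Type*} [MeasurableSpace Ω] {P : Measure Ω}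
  {F : Measure (Cube d)} {ν : Measure ℝ} {X : ℕ → Ω → Cube d} {ε : ℕ → ℕ → Ω → ℝ}

theorem IsDoseResponseDesign.iIndepFun_pair [IsProbabilityMeasure P]
    (h : IsDoseResponseDesign P F ν X ε) (m : ℕ) :
    iIndepFun (fun i ω => (X i ω, scaledError ε m i ω)) P := by
  refine iIndepFun.prodMk_of_indepFun h.measurable_X (h.measurable_scaledError m) h.indep_X ?_ ?_
  · exact (iIndepFun.curry h.measurable_err h.indep_err).comp
      (fun _ e => (√(m : ℝ))⁻¹ * ∑ j ∈ Finset.range m, e j) (fun _ => by fun_prop)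
  · exact h.indep_X_err.comp measurable_id
      (ψ := fun e i => (√(m : ℝ))⁻¹ * ∑ j ∈ Finset.range m, e (i, j)) (by fun_prop)

theorem IsDoseResponseDesign.map_scaledError (h : IsDoseResponseDesign P F ν X ε) (m i : ℕ) :
    P.map (scaledError ε m i) = P.map (scaledError ε m 0) := by
  have hrow : ∀ i, P.map (fun ω j => ε i j ω) = Measure.infinitePi fun j => P.map (ε i j) :=
    fun i => (h.indep_err.precomp (g := fun j : ℕ => (i, j))
      (fun _ _ hij => by simpa using hij)).map_fun_eq_infinitePi_map (h.measurable_err i)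
  have hcomp : ∀ i, P.map (scaledError ε m i) = (P.map (fun ω j => ε i j ω)).map
      (fun e => (√(m : ℝ))⁻¹ * ∑ j ∈ Finset.range m, e j) := fun i => by
    rw [Measure.map_map (by fun_prop) (measurable_pi_lambda _ (h.measurable_err i))]
    rfl
  rw [hcomp, hcomp, hrow, hrow]
  simp_rw [h.law_err]

theorem IsDoseResponseDesign.map_pair [IsProbabilityMeasure P]
    (h : IsDoseResponseDesign P F ν X ε) (m i : ℕ) :
    P.map (fun ω => (X i ω, scaledError ε m i ω)) = F.prod (P.map (scaledError ε m 0)) := by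
  have hind : IndepFun (X i) (scaledError ε m i) P :=
    h.indep_X_err.comp (φ := fun x : ℕ → Cube d => x i)
      (ψ := fun e : ℕ × ℕ → ℝ => (√(m : ℝ))⁻¹ * ∑ j ∈ Finset.range m, e (i, j))
      (measurable_pi_apply i) (by fun_prop)
  rw [(indepFun_iff_map_prod_eq_prod_map_map (h.measurable_X i).aemeasurable
    (h.measurable_scaledError m i).aemeasurable).1 hind, h.law_X, h.map_scaledError]

end Design

/-! ### Moments of the bracket increments. -/

section LowerIncrement

variable {α β : Type*}

/-- A lower bound for the increment `q(x, z) (1_S(x) - 1_{S₀}(x))` that is valid for all `S`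
between `L` and `U`, provided that `-1 ≤ q`. -/
noncomputable def lowerIncrement (q : α → β → ℝ) (S₀ L U : Set α) (v : α × β) : ℝ :=
  q v.1 v.2 * (L.indicator 1 v.1 - S₀.indicator 1 v.1) - (U \ L).indicator 1 v.1

theorem measurable_lowerIncrement [MeasurableSpace α] [MeasurableSpace β] {q : α → β → ℝ} (hq : Measurable (Function.uncurry q))
    {S₀ L U : Set α} (hS₀ : MeasurableSet S₀) (hL : MeasurableSet L) (hU : MeasurableSet U) :
    Measurable (lowerIncrement q S₀ L U) := by
  have h1 : ∀ {A : Set α}, MeasurableSet A →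
      Measurable fun v : α × β => A.indicator (1 : α → ℝ) v.1 := fun hA =>
    (measurable_one.indicator hA).comp measurable_fst
  exact (hq.mul ((h1 hL).sub (h1 hS₀))).sub (h1 (hU.diff hL))

theorem abs_lowerIncrement_le {q : α → β → ℝ} (hq : ∀ x z, |q x z| ≤ 1) (S₀ L U : Set α)
    (v : α × β) : |lowerIncrement q S₀ L U v| ≤ 2 := by
  have h := abs_le.1 (hq v.1 v.2)
  rw [abs_le, lowerIncrement]
  by_cases h1 : v.1 ∈ L <;> by_cases h2 : v.1 ∈ S₀ <;> by_cases h3 : v.1 ∈ U <;>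
    simp [h1, h2, h3] <;> (try constructor) <;> linarith

/-- From `(a + b)² ≤ 2 a² + 2 b²`. The bound is linear in the indicators, which makes the second
moment comparable to the mean. -/
theorem lowerIncrement_sq_le {q : α → β → ℝ} (hq : ∀ x z, |q x z| ≤ 1) (S₀ L U : Set α)
    (v : α × β) : lowerIncrement q S₀ L U v ^ 2 ≤
      2 * (L ∆ S₀).indicator 1 v.1 + 2 * (U \ L).indicator 1 v.1 := by
  have h := abs_le.1 (hq v.1 v.2)
  rw [lowerIncrement]
  by_cases h1 : v.1 ∈ L <;> by_cases h2 : v.1 ∈ S₀ <;> by_cases h3 : v.1 ∈ U <;>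
    simp [h1, h2, h3, Set.mem_symmDiff, Set.indicator] <;> nlinarith

theorem lowerIncrement_le_sub {q : α → β → ℝ} (hq : ∀ x z, |q x z| ≤ 1) {S₀ L U S : Set α}
    (hL : L ⊆ S) (hU : S ⊆ U) (v : α × β) :
    lowerIncrement q S₀ L U v ≤
      S.indicator (fun x => q x v.2) v.1 - S₀.indicator (fun x => q x v.2) v.1 := by
  have h := abs_le.1 (hq v.1 v.2)
  have h1 := @hL v.1
  have h2 := @hU v.1
  rw [lowerIncrement]
  by_cases h3 : v.1 ∈ L <;> by_cases h4 : v.1 ∈ S₀ <;> by_cases h5 : v.1 ∈ U <;>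
    by_cases h6 : v.1 ∈ S <;> (simp_all; try linarith)

variable [MeasurableSpace α] [MeasurableSpace β] {F : Measure α} [IsProbabilityMeasure F] {ζ : Measure β} [IsProbabilityMeasure ζ]

theorem integral_lowerIncrement_sq_le {q : α → β → ℝ} (hq : ∀ x z, |q x z| ≤ 1)
    {S₀ L U : Set α} (hS₀ : MeasurableSet S₀) (hL : MeasurableSet L) (hU : MeasurableSet U) :
    ∫ v, lowerIncrement q S₀ L U v ^ 2 ∂(F.prod ζ) ≤
      2 * F.real (L ∆ S₀) + 2 * F.real (U \ L) := by
  have i1 : ∀ {A : Set α}, MeasurableSet A → Integrable (A.indicator (1 : α → ℝ)) F := fun hA =>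
    (integrable_const (1 : ℝ)).indicator hA
  have i2 : Integrable (fun x => 2 * (L ∆ S₀).indicator (1 : α → ℝ) x
      + 2 * (U \ L).indicator 1 x) F :=
    ((i1 (hL.symmDiff hS₀)).const_mul 2).add ((i1 (hU.diff hL)).const_mul 2)
  calc ∫ v, lowerIncrement q S₀ L U v ^ 2 ∂(F.prod ζ)
      ≤ ∫ v, (2 * (L ∆ S₀).indicator (1 : α → ℝ) v.1 + 2 * (U \ L).indicator 1 v.1) ∂(F.prod ζ) :=
        integral_mono_of_nonneg (ae_of_all _ fun v => sq_nonneg _) (i2.comp_fst ζ)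
          (ae_of_all _ fun v => lowerIncrement_sq_le hq S₀ L U v)
    _ = ∫ x, (2 * (L ∆ S₀).indicator (1 : α → ℝ) x + 2 * (U \ L).indicator 1 x) ∂F := by
        rw [integral_fun_fst (μ := F) (ν := ζ) (fun x => 2 * (L ∆ S₀).indicator (1 : α → ℝ) x
          + 2 * (U \ L).indicator 1 x)]
        simp
    _ = 2 * F.real (L ∆ S₀) + 2 * F.real (U \ L) := by
        rw [integral_add ((i1 (hL.symmDiff hS₀)).const_mul 2) ((i1 (hU.diff hL)).const_mul 2),
          integral_const_mul, integral_const_mul, integral_indicator_one (hL.symmDiff hS₀),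
          integral_indicator_one (hU.diff hL)]

/-- Integrate over `z` by Fubini. Each point of `L ∆ S₀` then contributes at least `c`, except on
`B`, where only the lower bound `-1 ≥ c - 2` is available. -/
theorem le_integral_lowerIncrement {q : α → β → ℝ} (mq : Measurable (Function.uncurry q))
    (hq : ∀ x z, |q x z| ≤ 1) {S₀ L U B : Set α} (hS₀ : MeasurableSet S₀) (hL : MeasurableSet L)
    (hU : MeasurableSet U) (hB : MeasurableSet B) {c : ℝ} (hc : c ≤ 1)
    (hneg : ∀ x ∈ S₀, ∫ z, q x z ∂ζ ≤ -c) (hpos : ∀ x ∉ S₀, x ∉ B → c ≤ ∫ z, q x z ∂ζ) :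
    c * F.real (L ∆ S₀) - 2 * F.real B - F.real (U \ L) ≤
      ∫ v, lowerIncrement q S₀ L U v ∂(F.prod ζ) := by
  have i1 : ∀ {A : Set α}, MeasurableSet A → Integrable (A.indicator (1 : α → ℝ)) F := fun hA =>
    (integrable_const (1 : ℝ)).indicator hA
  have iprod : Integrable (lowerIncrement q S₀ L U) (F.prod ζ) :=
    Integrable.of_mem_Icc (-2) 2 (measurable_lowerIncrement mq hS₀ hL hU).aemeasurable
      (ae_of_all _ fun v => abs_le.1 (abs_lowerIncrement_le hq S₀ L U v))
  have iq : ∀ x, Integrable (q x) ζ := fun x =>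
    Integrable.of_mem_Icc (-1) 1 (mq.comp measurable_prodMk_left).aemeasurable
      (ae_of_all _ fun z => abs_le.1 (hq x z))
  have hinner : ∀ x, ∫ z, lowerIncrement q S₀ L U (x, z) ∂ζ =
      (∫ z, q x z ∂ζ) * (L.indicator 1 x - S₀.indicator 1 x) - (U \ L).indicator 1 x := by
    intro x
    simp only [lowerIncrement]
    rw [integral_sub ((iq x).mul_const _) (integrable_const _), integral_mul_const]
    simp
  have hbar : ∀ x, -1 ≤ ∫ z, q x z ∂ζ ∧ ∫ z, q x z ∂ζ ≤ 1 := fun x => by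
    have h1 := integral_mono (integrable_const (-1)) (iq x) (fun z => (abs_le.1 (hq x z)).1)
    have h2 := integral_mono (iq x) (integrable_const 1) (fun z => (abs_le.1 (hq x z)).2)
    simp at h1 h2
    exact ⟨h1, h2⟩
  have i2 : Integrable (fun x => c * (L ∆ S₀).indicator (1 : α → ℝ) x
      - 2 * B.indicator (1 : α → ℝ) x) F :=
    ((i1 (hL.symmDiff hS₀)).const_mul c).sub ((i1 hB).const_mul 2)
  rw [integral_prod _ iprod]
  calc c * F.real (L ∆ S₀) - 2 * F.real B - F.real (U \ L)
      = ∫ x, (c * (L ∆ S₀).indicator (1 : α → ℝ) x - 2 * B.indicator 1 x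
          - (U \ L).indicator 1 x) ∂F := by
        rw [integral_sub i2 (i1 (hU.diff hL)), integral_sub ((i1 (hL.symmDiff hS₀)).const_mul c)
          ((i1 hB).const_mul 2), integral_const_mul, integral_const_mul,
          integral_indicator_one (hL.symmDiff hS₀), integral_indicator_one (hU.diff hL),
          integral_indicator_one hB]
    _ ≤ ∫ x, ∫ z, lowerIncrement q S₀ L U (x, z) ∂ζ ∂F := by
        refine integral_mono (i2.sub (i1 (hU.diff hL))) iprod.integral_prod_left fun x => ?_
        rw [hinner x]
        obtain ⟨hb1, hb2⟩ := hbar x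
        have h5 := hneg x
        have h6 := hpos x
        generalize ∫ z, q x z ∂ζ = w at *
        clear hneg hpos hbar hinner iq iprod i1 i2
        by_cases h1 : x ∈ L <;> by_cases h2 : x ∈ S₀ <;> by_cases h3 : x ∈ U <;>
          by_cases h4 : x ∈ B <;>
          simp_all [Set.mem_symmDiff, Set.indicator] <;> linarith

end LowerIncrement

/-! ### The mass of the region where the weights are not yet separated. -/

/-- The set of points outside the baseline set at which the regression function, scaled by `√m`,
does not exceed `τ₀` by at least `t`. -/
def nearBaseline {d : ℕ} (μ : Cube d → ℝ) (τ₀ t : ℝ) (m : ℕ) : Set (Cube d) :=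
  {x | x ∉ baseline μ τ₀ ∧ √(m : ℝ) * (μ x - τ₀) < t}

section Regression

variable {d : ℕ} {μ : Cube d → ℝ} {τ₀ : ℝ}

theorem measurableSet_baseline (hμ : Continuous μ) : MeasurableSet (baseline μ τ₀) :=
  hμ.measurable (measurableSet_singleton τ₀)

theorem measurableSet_nearBaseline (hμ : Continuous μ) (t : ℝ) (m : ℕ) :
    MeasurableSet (nearBaseline μ τ₀ t m) :=
  (measurableSet_baseline hμ).compl.inter
    (measurableSet_lt ((hμ.measurable.sub_const τ₀).const_mul _) measurable_const)

theorem sub_pos_of_notMem_baseline (hτ₀ : ∀ x, τ₀ ≤ μ x) {x : Cube d} (hx : x ∉ baseline μ τ₀) :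
    0 < μ x - τ₀ :=
  sub_pos.2 (lt_of_le_of_ne (hτ₀ x) fun h => hx h.symm)

theorem tendsto_sqrt_natCast_atTop : Tendsto (fun m : ℕ => √(m : ℝ)) atTop atTop :=
  Real.tendsto_sqrt_atTop.comp tendsto_natCast_atTop_atTop

/-- Each fixed point off the baseline set eventually leaves, since `√m (μ(x) - τ₀) → ∞`; then
dominated convergence applies. -/
theorem tendsto_measureReal_nearBaseline (F : Measure (Cube d)) [IsFiniteMeasure F]
    (hμ : Continuous μ) (hτ₀ : ∀ x, τ₀ ≤ μ x) (t : ℝ) :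
    Tendsto (fun m => F.real (nearBaseline μ τ₀ t m)) atTop (𝓝 0) := by
  have h : Tendsto (fun m => F (nearBaseline μ τ₀ t m)) atTop (𝓝 (F ∅)) := by
    refine tendsto_measure_of_ae_tendsto_indicator_of_isFiniteMeasure atTop MeasurableSet.empty
      (fun m => measurableSet_nearBaseline hμ t m) (ae_of_all _ fun x => ?_)
    by_cases hx : x ∈ baseline μ τ₀
    · exact Eventually.of_forall fun m => by simp [nearBaseline, hx]
    · have h1 := tendsto_sqrt_natCast_atTop.atTop_mul_const (sub_pos_of_notMem_baseline hτ₀ hx)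
      filter_upwards [h1.eventually_ge_atTop t] with m hm
      simp [nearBaseline, hm]
  rw [measure_empty] at h
  exact (ENNReal.tendsto_toReal ENNReal.zero_ne_top).comp h

/-- Away from the baseline set the regression function exceeds `τ₀` by a constant. -/
theorem exists_pos_le_sub_of_le_infDist (hμ : Continuous μ) (hτ₀ : ∀ x, τ₀ ≤ μ x) {κ : ℝ}
    (hκ : 0 < κ) : ∃ η > 0, ∀ x, κ ≤ Metric.infDist x (baseline μ τ₀) → η ≤ μ x - τ₀ := by
  set K : Set (Cube d) := {x | κ ≤ Metric.infDist x (baseline μ τ₀)} with hKdef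
  have hK : IsCompact K :=
    (isClosed_le continuous_const (Metric.continuous_infDist_pt _)).isCompact
  rcases K.eq_empty_or_nonempty with hE | hne
  · refine ⟨1, one_pos, fun x hx => ?_⟩
    have : x ∈ K := hx
    simp [hE] at this
  · obtain ⟨x₀, hx₀, hmin⟩ := hK.exists_isMinOn hne (hμ.sub continuous_const).continuousOn
      (f := fun x => μ x - τ₀)
    refine ⟨μ x₀ - τ₀, sub_pos_of_notMem_baseline hτ₀ fun hmem => ?_, fun x hx => hmin hx⟩
    have h1 : κ ≤ Metric.infDist x₀ (baseline μ τ₀) := hx₀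
    rw [Metric.infDist_zero_of_mem hmem] at h1
    linarith

/-- `Metric.infDist` to the empty set is 0, so `exists_pos_le_sub_of_le_infDist` is vacuous here;
compactness of the whole cube is used instead. -/
theorem nearBaseline_eq_empty_of_baseline_eq_empty (hμ : Continuous μ) (hτ₀ : ∀ x, τ₀ ≤ μ x)
    (hE : baseline μ τ₀ = ∅) (t : ℝ) : ∀ᶠ m in atTop, nearBaseline μ τ₀ t m = ∅ := by
  have hx₀ : ∃ η > 0, ∀ x, η ≤ μ x - τ₀ := by
    obtain ⟨x₀, -, hmin⟩ := isCompact_univ.exists_isMinOn Set.univ_nonempty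
      (hμ.sub continuous_const).continuousOn (f := fun x => μ x - τ₀)
    exact ⟨μ x₀ - τ₀, sub_pos_of_notMem_baseline hτ₀ (by simp [hE]), fun x => hmin trivial⟩
  obtain ⟨η, hη, hle⟩ := hx₀
  filter_upwards [(tendsto_sqrt_natCast_atTop.atTop_mul_const hη).eventually_ge_atTop t] with m hm
  refine Set.eq_empty_of_forall_notMem fun x hx => ?_
  have h1 := hx.2
  have h2 := mul_le_mul_of_nonneg_left (hle x) (Real.sqrt_nonneg (m : ℝ))
  linarith

/-- Under `p`-regularity and a linear bound on the mass near the boundary, the set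
`nearBaseline` has mass of order `m^{-1/(2p)}`. -/
theorem PRegular.exists_measureReal_nearBaseline_le {F : Measure (Cube d)} [IsFiniteMeasure F]
    (hμ : Continuous μ) (hτ₀ : ∀ x, τ₀ ≤ μ x) {p : ℝ} (hp : 0 < p) (hreg : PRegular μ τ₀ p)
    {c : ℝ} (hF : ∀ δ : ℝ, 0 < δ →
      F.real (Metric.thickening δ (baseline μ τ₀) \ thinning δ (baseline μ τ₀)) ≤ c * δ) (t : ℝ) :
    ∃ C : ℝ, ∀ᶠ m : ℕ in atTop,
      F.real (nearBaseline μ τ₀ t m) ≤ C * (m : ℝ) ^ (-(1 / (2 * p))) := by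
  rcases (baseline μ τ₀).eq_empty_or_nonempty with hE | hne
  · refine ⟨0, ?_⟩
    filter_upwards [nearBaseline_eq_empty_of_baseline_eq_empty hμ hτ₀ hE t] with m hm
    simp [hm]
  obtain ⟨κ₀, hκ₀, C₀, hC₀, hreg⟩ := hreg
  obtain ⟨η, hη, hfar⟩ := exists_pos_le_sub_of_le_infDist hμ hτ₀ hκ₀
  -- Nothing makes `t` positive, while the radius below must be.
  set s : ℝ := max t 1 with hs
  have hs1 : 0 < s := lt_max_of_lt_right one_pos
  refine ⟨c * (2 * (s / C₀) ^ (1 / p)), ?_⟩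
  filter_upwards [(tendsto_sqrt_natCast_atTop.atTop_mul_const hη).eventually_ge_atTop t,
    eventually_gt_atTop 0] with m hm hm0
  have hm0' : (0 : ℝ) < m := by exact_mod_cast hm0
  have hsq : 0 < √(m : ℝ) := Real.sqrt_pos.2 hm0'
  -- The radius solves `√m · C₀ ρ^p = s`, the point where regularity brings the scaled regression
  -- function up to `s ≥ t`.
  set ρ : ℝ := (s / C₀) ^ (1 / p) * (m : ℝ) ^ (-(1 / (2 * p))) with hρ
  have hρ0 : 0 < ρ := by positivity
  have hρp : ρ ^ p = s / C₀ / √(m : ℝ) := by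
    rw [hρ, Real.mul_rpow (by positivity) (by positivity), ← Real.rpow_mul (by positivity),
      ← Real.rpow_mul hm0'.le, one_div_mul_cancel hp.ne', Real.rpow_one,
      show -(1 / (2 * p)) * p = -(1 / 2) by field_simp, Real.rpow_neg hm0'.le,
      ← Real.sqrt_eq_rpow]
    rfl
  -- The factor 2 turns `infDist ≤ ρ` into the strict inequality of a thickening. Points off the
  -- baseline set have distance 0 to its complement, hence lie outside the thinning.
  calc F.real (nearBaseline μ τ₀ t m)
      ≤ F.real (Metric.thickening (2 * ρ) (baseline μ τ₀) \
          thinning (2 * ρ) (baseline μ τ₀)) := by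
        refine measureReal_mono ?_
        rintro x ⟨hx, hlt⟩
        have hclose : Metric.infDist x (baseline μ τ₀) < κ₀ := by
          by_contra! hge
          have := mul_le_mul_of_nonneg_left (hfar x hge) hsq.le
          linarith
        have h1 := hreg x hx hclose
        refine ⟨?_, ?_⟩
        · rw [Metric.mem_thickening_iff_infDist_lt hne]
          have h2 : Metric.infDist x (baseline μ τ₀) ^ p ≤ ρ ^ p := by
            rw [hρp, div_div, le_div_iff₀ (by positivity)]
            have h3 := mul_le_mul_of_nonneg_left h1 hsq.le
            have h4 : t ≤ s := le_max_left _ _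
            linarith
          have h5 := (Real.rpow_le_rpow_iff Metric.infDist_nonneg hρ0.le hp).1 h2
          linarith
        · simp only [thinning, Set.mem_ofPred_eq, not_le]
          rw [Metric.infEDist_zero_of_mem (by exact hx)]
          exact ENNReal.ofReal_pos.2 (by positivity)
    _ ≤ c * (2 * ρ) := hF _ (by positivity)
    _ = c * (2 * (s / C₀) ^ (1 / p)) * (m : ℝ) ^ (-(1 / (2 * p))) := by rw [hρ]; ring

end Regression

/-! ### The exponential deviation inequality. -/

section Deviation

variable {d : ℕ} {Ω : Type*} {μ : Cube d → ℝ} {τ₀ γ : ℝ} {X : ℕ → Ω → Cube d}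
  {ε : ℕ → ℕ → Ω → ℝ}

/-- The centred weight `Φ(√m (μ(x) - τ₀) + z) - γ` at the covariate `x`, where `z` is the
standardized average of the errors. -/
noncomputable def centredWeight (μ : Cube d → ℝ) (τ₀ γ : ℝ) (m : ℕ) (x : Cube d) (z : ℝ) : ℝ :=
  stdNormalCDF (√(m : ℝ) * (μ x - τ₀) + z) - γ

theorem sqrt_mul_meanResponse_sub {m : ℕ} (hm : 0 < m) (i : ℕ) (ω : Ω) :
    √(m : ℝ) * (meanResponse μ X ε m i ω - τ₀) =
      √(m : ℝ) * (μ (X i ω) - τ₀) + scaledError ε m i ω := by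
  have hm' : (0 : ℝ) < m := by exact_mod_cast hm
  have hsq : 0 < √(m : ℝ) := Real.sqrt_pos.2 hm'
  have hss : √(m : ℝ) * √(m : ℝ) = m := Real.mul_self_sqrt hm'.le
  simp only [meanResponse, response, scaledError, Finset.sum_add_distrib, Finset.sum_const,
    Finset.card_range, nsmul_eq_mul]
  generalize ∑ j ∈ Finset.range m, ε i j ω = s
  rw [add_div, mul_div_cancel_left₀ _ hm'.ne']
  have : √(m : ℝ) * (s / m) = (√(m : ℝ))⁻¹ * s := by
    rw [← hss]; field_simp; rw [Real.sqrt_sq hsq.le]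
  linarith

theorem empCriterion_eq {m : ℕ} (hm : 0 < m) (n : ℕ) (ω : Ω) (S : Set (Cube d)) :
    empCriterion μ τ₀ γ X ε m n ω S = (∑ i ∈ Finset.range n,
      S.indicator (fun x => centredWeight μ τ₀ γ m x (scaledError ε m i ω)) (X i ω)) / n := by
  classical
  simp only [empCriterion, Set.indicator, centredWeight, sqrt_mul_meanResponse_sub hm]

theorem abs_centredWeight_le (hγ₁ : 1 / 2 < γ) (hγ₂ : γ < 1) (m : ℕ) (x : Cube d) (z : ℝ) :
    |centredWeight μ τ₀ γ m x z| ≤ 1 := by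
  have h1 := stdNormalCDF_nonneg (√(m : ℝ) * (μ x - τ₀) + z)
  have h2 := stdNormalCDF_le_one (√(m : ℝ) * (μ x - τ₀) + z)
  rw [abs_le, centredWeight]
  constructor <;> linarith

theorem measurable_centredWeight (hμ : Continuous μ) (m : ℕ) :
    Measurable (Function.uncurry (centredWeight μ τ₀ γ m)) := by
  have h1 : Measurable fun v : Cube d × ℝ => √(m : ℝ) * (μ v.1 - τ₀) + v.2 := by
    have := hμ.measurable
    fun_prop
  exact (measurable_stdNormalCDF.comp h1).sub measurable_const

theorem integral_centredWeight (ζ : Measure ℝ) [IsProbabilityMeasure ζ] (m : ℕ) (x : Cube d) :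
    ∫ z, centredWeight μ τ₀ γ m x z ∂ζ = smoothedCDF ζ (√(m : ℝ) * (μ x - τ₀)) - γ := by
  simp only [centredWeight]
  rw [integral_sub (integrable_stdNormalCDF_add ζ _) (integrable_const _)]
  simp [smoothedCDF]

variable [MeasurableSpace Ω] {P : Measure Ω} [IsProbabilityMeasure P] {F : Measure (Cube d)}
  [IsProbabilityMeasure F] {ν : Measure ℝ} {𝒮 : Set (Set (Cube d))}

/-- The exponential inequality behind consistency and rates: with many replicates, a minimizer of
the empirical criterion is unlikely to be at distance more than `δ` from the baseline set, if the
class is covered by few brackets of size proportional to `δ`. -/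
theorem IsDoseResponseDesign.measure_lt_distF_le (h : IsDoseResponseDesign P F ν X ε)
    (hμ : Continuous μ) (hγ₁ : 1 / 2 < γ) (hγ₂ : γ < 1) {m n k : ℕ} (hm : 0 < m) (hn : 0 < n)
    {t δ : ℝ} (hδ : 0 < δ)
    (hlow : smoothedCDF (P.map (scaledError ε m 0)) 0 ≤ γ - margin γ)
    (hupp : γ + margin γ ≤ smoothedCDF (P.map (scaledError ε m 0)) t)
    (hnear : F.real (nearBaseline μ τ₀ t m) ≤ margin γ * δ / 32)
    (hcov : CoveredBySetBrackets F 𝒮 (margin γ * δ / 64) k)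
    {Sn : Ω → Set (Cube d)} (hSn : ∀ ω, Sn ω ∈ 𝒮)
    (hmin : ∀ ω, empCriterion μ τ₀ γ X ε m n ω (Sn ω) ≤
      empCriterion μ τ₀ γ X ε m n ω (baseline μ τ₀)) :
    P {ω | δ < distF F (Sn ω) (baseline μ τ₀)} ≤
      ENNReal.ofReal (k * Real.exp (-(margin γ ^ 2 / 32 * δ * n))) := by
  obtain ⟨L, U, hLU, hcov⟩ := hcov
  have hc0 := margin_pos hγ₁ hγ₂
  have hc1 := margin_le γ
  set c := margin γ
  set S₀ := baseline μ τ₀ with hS₀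
  set ζ := P.map (scaledError ε m 0)
  have hζ : IsProbabilityMeasure ζ :=
    Measure.isProbabilityMeasure_map (h.measurable_scaledError m 0).aemeasurable
  set q := centredWeight μ τ₀ γ m
  have hq : ∀ x z, |q x z| ≤ 1 := abs_centredWeight_le hγ₁ hγ₂ m
  have mq : Measurable (Function.uncurry q) := measurable_centredWeight hμ m
  have mS₀ : MeasurableSet S₀ := measurableSet_baseline hμ
  let V : ℕ → Ω → Cube d × ℝ := fun i ω => (X i ω, scaledError ε m i ω)
  let E : Fin k → Set Ω := fun j =>
    {ω | ∑ i ∈ Finset.range n, lowerIncrement q S₀ (L j) (U j) (V i ω) ≤ 0}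
  have hE : ∀ j, δ / 2 ≤ distF F (L j) S₀ →
      P (E j) ≤ ENNReal.ofReal (Real.exp (-(c ^ 2 / 32 * δ * n))) := by
    intro j hj
    obtain ⟨mL, mU, ha⟩ := hLU j
    rw [← ofReal_measureReal]
    refine ENNReal.ofReal_le_ofReal ?_
    refine measureReal_sum_nonpos_le_exp (Q := F.prod ζ)
      (fun i => (h.measurable_X i).prodMk (h.measurable_scaledError m i))
      (h.iIndepFun_pair m) (h.map_pair m) (measurable_lowerIncrement mq mS₀ mL mU)
      (abs_lowerIncrement_le hq S₀ (L j) (U j)) (l := c / 4) (by positivity) (by linarith) ?_ n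
    have h1 := le_integral_lowerIncrement (F := F) (ζ := ζ) mq hq mS₀ mL mU
      (measurableSet_nearBaseline (τ₀ := τ₀) hμ t m) (c := c) (by linarith)
      (fun x hx => by
        rw [integral_centredWeight]
        have hx' : μ x = τ₀ := hx
        rw [hx', sub_self, mul_zero]
        linarith)
      (fun x hx hxB => by
        rw [integral_centredWeight]
        have hle : t ≤ √(m : ℝ) * (μ x - τ₀) := by
          by_contra! hlt
          exact hxB ⟨hx, hlt⟩
        have := monotone_smoothedCDF ζ hle
        linarith)
    have h2 := integral_lowerIncrement_sq_le (F := F) (ζ := ζ) hq mS₀ mL mU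
    have hD : δ / 2 ≤ F.real (L j ∆ S₀) := hj
    set D := F.real (L j ∆ S₀)
    set a := F.real (U j \ L j)
    set b := F.real (nearBaseline μ τ₀ t m)
    have ha0 : 0 ≤ a := measureReal_nonneg
    -- With `l = c/4`, the mean gains `c²D/4` and the second moment costs `c²D/8`, leaving at least
    -- `c²δ/16` as `D ≥ δ/2`. The near-baseline term costs `c²δ/64` and the two bracket terms at
    -- most `c²δ/256` each, so more than `c²δ/32` remains.
    refine le_trans ?_ (Real.add_one_le_exp _)
    have h3 := mul_le_mul_of_nonneg_left h1 (by positivity : 0 ≤ c / 4)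
    have h4 := mul_le_mul_of_nonneg_left h2 (by positivity : 0 ≤ (c / 4) ^ 2)
    have h5 : c / 4 * (c * δ / 4) ≤ c / 4 * (c / 2 * D) :=
      mul_le_mul_of_nonneg_left (by nlinarith) (by positivity)
    have h6 : c / 4 * (2 * b) ≤ c / 4 * (c * δ / 16) :=
      mul_le_mul_of_nonneg_left (by linarith) (by positivity)
    have h7 : c / 4 * a ≤ c / 4 * (c * δ / 64) :=
      mul_le_mul_of_nonneg_left ha (by positivity)
    have h8 : (c / 4) ^ 2 * (2 * a) ≤ c / 4 * a := by
      have : c / 4 * a * (c / 2) ≤ c / 4 * a * 1 :=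
        mul_le_mul_of_nonneg_left (by linarith) (by positivity)
      nlinarith
    have h9 : 0 ≤ c ^ 2 * δ := by positivity
    nlinarith
  have hsub : {ω | δ < distF F (Sn ω) S₀} ⊆
      ⋃ j ∈ Finset.univ.filter (fun j => δ / 2 ≤ distF F (L j) S₀), E j := by
    intro ω hω
    obtain ⟨j, hjL, hjU⟩ := hcov (Sn ω) (hSn ω)
    have hω' : δ < distF F (Sn ω) S₀ := hω
    -- The lower set `L j` inherits the distance of `Sn ω` up to `cδ/64 ≤ δ/2`, so only brackets
    -- covered by `hE` occur.
    have h1 := distF_le_add_of_subset (F := F) S₀ hjU hjL (hjL.trans hjU) subset_rfl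
    have h2 := (hLU j).2.2
    have h3 : c * δ / 64 ≤ δ / 2 := by nlinarith
    simp only [Set.mem_iUnion, Finset.mem_filter_univ]
    refine ⟨j, by linarith, ?_⟩
    have h4 := hmin ω
    rw [empCriterion_eq hm, empCriterion_eq hm,
      div_le_div_iff_of_pos_right (by exact_mod_cast hn : (0 : ℝ) < n)] at h4
    calc ∑ i ∈ Finset.range n, lowerIncrement q S₀ (L j) (U j) (V i ω)
        ≤ ∑ i ∈ Finset.range n,
          ((Sn ω).indicator (fun x => q x (scaledError ε m i ω)) (X i ω) -
            S₀.indicator (fun x => q x (scaledError ε m i ω)) (X i ω)) :=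
          Finset.sum_le_sum fun i _ => lowerIncrement_le_sub hq hjL hjU (V i ω)
      _ ≤ 0 := by rw [Finset.sum_sub_distrib]; exact sub_nonpos.2 h4
  calc P {ω | δ < distF F (Sn ω) S₀}
      ≤ ∑ j ∈ Finset.univ.filter (fun j => δ / 2 ≤ distF F (L j) S₀), P (E j) :=
        (measure_mono hsub).trans (measure_biUnion_finset_le _ _)
    _ ≤ ∑ j : Fin k, ENNReal.ofReal (Real.exp (-(c ^ 2 / 32 * δ * n))) :=
        (Finset.sum_le_sum fun j hj => hE j (Finset.mem_filter_univ j |>.1 hj)).trans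
          (Finset.sum_le_sum_of_subset (Finset.filter_subset _ _))
    _ = ENNReal.ofReal (k * Real.exp (-(c ^ 2 / 32 * δ * n))) := by
        rw [Finset.sum_const, Finset.card_univ, Fintype.card_fin,
          ENNReal.ofReal_mul (Nat.cast_nonneg _), ENNReal.ofReal_natCast, nsmul_eq_mul]

end Deviation

/-! ### Consistency and rate. -/

theorem CoveredBySetBrackets.mono {α : Type*} [MeasurableSpace α] {Q : Measure α}
    {𝒮 : Set (Set α)} {a b : ℝ} {k : ℕ} (h : CoveredBySetBrackets Q 𝒮 a k) (hab : a ≤ b) :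
    CoveredBySetBrackets Q 𝒮 b k := by
  obtain ⟨L, U, hLU, hcov⟩ := h
  exact ⟨L, U, fun i => ⟨(hLU i).1, (hLU i).2.1, (hLU i).2.2.trans hab⟩, hcov⟩

section Main

variable {d : ℕ} {Ω : Type*} [MeasurableSpace Ω] {P : Measure Ω} [IsProbabilityMeasure P]
  {F : Measure (Cube d)} [IsProbabilityMeasure F] {ν : Measure ℝ} {X : ℕ → Ω → Cube d}
  {ε : ℕ → ℕ → Ω → ℝ} {μ : Cube d → ℝ} {τ₀ γ : ℝ} {𝒮 : Set (Set (Cube d))}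

/-- For fixed `δ` the number of brackets does not depend on `n`, so the exponential factor wins. -/
theorem IsDoseResponseDesign.tendsto_measure_lt_distF (h : IsDoseResponseDesign P F ν X ε)
    (hμ : Continuous μ) (hτ₀ : ∀ x, τ₀ ≤ μ x) (hγ₁ : 1 / 2 < γ) (hγ₂ : γ < 1)
    (hS₀ : baseline μ τ₀ ∈ 𝒮) (hcov : ∀ a : ℝ, 0 < a → ∃ k, CoveredBySetBrackets F 𝒮 a k)
    {m : ℕ → ℕ} (hm : Tendsto m atTop atTop) {Sn : ℕ → Ω → Set (Cube d)}
    (hSn : IsArgminEstimator μ τ₀ γ X ε m 𝒮 Sn) {δ : ℝ} (hδ : 0 < δ) :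
    Tendsto (fun n => P {ω | δ < distF F (Sn n ω) (baseline μ τ₀)}) atTop (𝓝 0) := by
  obtain ⟨t, ht⟩ := h.exists_smoothedCDF_separated hγ₁ hγ₂
  have hc0 := margin_pos hγ₁ hγ₂
  obtain ⟨k, hk⟩ := hcov (margin γ * δ / 64) (by positivity)
  have hnear := (tendsto_measureReal_nearBaseline F hμ hτ₀ t).eventually_le_const
    (show 0 < margin γ * δ / 32 by positivity)
  have hlim : Tendsto (fun n : ℕ =>
      ENNReal.ofReal (k * Real.exp (-(margin γ ^ 2 / 32 * δ * n)))) atTop (𝓝 0) := by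
    rw [← ENNReal.ofReal_zero, ← mul_zero (k : ℝ)]
    refine (ENNReal.continuous_ofReal.tendsto _).comp (Tendsto.const_mul _ ?_)
    exact Real.tendsto_exp_neg_atTop_nhds_zero.comp
      (tendsto_natCast_atTop_atTop.const_mul_atTop (by positivity))
  refine tendsto_of_tendsto_of_tendsto_of_le_of_le' tendsto_const_nhds hlim
    (Eventually.of_forall fun n => zero_le) ?_
  filter_upwards [hm.eventually ht, hm.eventually hnear, hm.eventually (eventually_gt_atTop 0),
    eventually_gt_atTop 0] with n h1 h2 h3 h4
  exact h.measure_lt_distF_le hμ hγ₁ hγ₂ h3 h4 hδ h1.1 h1.2 h2 hk (fun ω => (hSn n ω).1)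
    (fun ω => (hSn n ω).2 hS₀)

/-- A class with bounded bracketing numbers is essentially finite, so that the estimator
eventually agrees with the baseline set up to null sets, with probability tending to one. -/
theorem IsDoseResponseDesign.tendsto_measure_distF_pos (h : IsDoseResponseDesign P F ν X ε)
    (hμ : Continuous μ) (hτ₀ : ∀ x, τ₀ ≤ μ x) (hγ₁ : 1 / 2 < γ) (hγ₂ : γ < 1)
    (hS₀ : baseline μ τ₀ ∈ 𝒮) {N : ℕ}
    (hcov : ∀ a : ℝ, 0 < a → a ≤ 1 → ∃ k ≤ N, CoveredBySetBrackets F 𝒮 a k)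
    {m : ℕ → ℕ} (hm : Tendsto m atTop atTop) {Sn : ℕ → Ω → Set (Cube d)}
    (hSn : IsArgminEstimator μ τ₀ γ X ε m 𝒮 Sn) :
    Tendsto (fun n => P {ω | 0 < distF F (Sn n ω) (baseline μ τ₀)}) atTop (𝓝 0) := by
  obtain ⟨η, hη, hgap⟩ := exists_pos_le_distF_of_finite (finite_distF_image (baseline μ τ₀) hcov)
  have hcov' : ∀ a : ℝ, 0 < a → ∃ k, CoveredBySetBrackets F 𝒮 a k := fun a ha => by
    obtain ⟨k, -, hk⟩ := hcov (min a 1) (lt_min ha one_pos) (min_le_right _ _)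
    exact ⟨k, hk.mono (min_le_left _ _)⟩
  refine tendsto_of_tendsto_of_tendsto_of_le_of_le tendsto_const_nhds
    (h.tendsto_measure_lt_distF hμ hτ₀ hγ₁ hγ₂ hS₀ hcov' hm hSn hη) (fun n => zero_le)
    fun n => measure_mono fun ω hω => hgap _ (hSn n ω).1 hω

/-- The balance of entropy against exponent: the claim amounts to `A'/c ≤ δ^{1+s} n`, and `α =
1/(1+s)` is the matching rate. It is applied with `s = r/2`. -/
theorem mul_rpow_neg_le_of_rate_le {A' c K δ s α : ℝ} {n : ℕ} (hn : 0 < n) (hs : 0 < s)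
    (hα : α * (1 + s) = 1) (hc : 0 < c) (hK : 1 ≤ K) (hKA : A' / c ≤ K)
    (hδ : K * (n : ℝ) ^ (-α) ≤ δ) : A' * δ ^ (-s) ≤ c * δ * n := by
  have hn' : (0 : ℝ) < n := by exact_mod_cast hn
  have hδ0 : 0 < δ := lt_of_lt_of_le (by positivity) hδ
  have h1 : K / n ≤ δ ^ (1 + s) := by
    calc K / n ≤ K ^ (1 + s) * (n : ℝ) ^ (-α * (1 + s)) := by
          rw [neg_mul, hα, Real.rpow_neg_one, div_eq_mul_inv]
          have : K ≤ K ^ (1 + s) := by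
            simpa using Real.rpow_le_rpow_of_exponent_le hK (show (1 : ℝ) ≤ 1 + s by linarith)
          gcongr
      _ = (K * (n : ℝ) ^ (-α)) ^ (1 + s) := by
          rw [Real.mul_rpow (by positivity) (by positivity), ← Real.rpow_mul hn'.le]
      _ ≤ δ ^ (1 + s) := Real.rpow_le_rpow (by positivity) hδ (by linarith)
  have h2 : A' ≤ c * δ ^ (1 + s) * n := by
    have h3 : A' ≤ K * c := (div_le_iff₀ hc).1 hKA
    have h4 : K ≤ δ ^ (1 + s) * n := (div_le_iff₀ hn').1 h1
    nlinarith
  calc A' * δ ^ (-s) ≤ c * δ ^ (1 + s) * n * δ ^ (-s) := by gcongr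
    _ = c * (δ ^ (1 + s) * δ ^ (-s)) * n := by ring
    _ = c * δ * n := by rw [← Real.rpow_add hδ0]; simp

theorem IsDoseResponseDesign.exists_rate (h : IsDoseResponseDesign P F ν X ε)
    (hμ : Continuous μ) (hτ₀ : ∀ x, τ₀ ≤ μ x) (hγ₁ : 1 / 2 < γ) (hγ₂ : γ < 1)
    (hS₀ : baseline μ τ₀ ∈ 𝒮) {p : ℝ} (hp : 0 < p) (hreg : PRegular μ τ₀ p) {c₁ : ℝ}
    (hF : ∀ δ : ℝ, 0 < δ →
      F.real (Metric.thickening δ (baseline μ τ₀) \ thinning δ (baseline μ τ₀)) ≤ c₁ * δ)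
    {r : ℝ} (hr : 0 < r) {A : ℝ}
    (hA : ∀ u : ℝ, 0 < u → u ≤ 1 →
      bracketingEntropy F (indicators 𝒮) u ≤ ((A * u ^ (-r) : ℝ) : EReal)) :
    ∃ K₁ : ℝ, 0 < K₁ ∧ ∀ m : ℕ → ℕ, Tendsto m atTop atTop →
      ∀ Sn : ℕ → Ω → Set (Cube d), IsArgminEstimator μ τ₀ γ X ε m 𝒮 Sn →
      Tendsto (fun n : ℕ =>
        P {ω | K₁ * max ((n : ℝ) ^ (-(2 / (2 + r)))) ((m n : ℝ) ^ (-(1 / (2 * p))))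
          < distF F (Sn n ω) (baseline μ τ₀)}) atTop (𝓝 0) := by
  obtain ⟨t, ht⟩ := h.exists_smoothedCDF_separated hγ₁ hγ₂
  obtain ⟨C, hC⟩ := hreg.exists_measureReal_nearBaseline_le hμ hτ₀ hp hF t
  have hc0 := margin_pos hγ₁ hγ₂
  have hc1 := margin_le γ
  set c := margin γ
  set A' : ℝ := |A| * (c / 64) ^ (-(r / 2)) with hA'
  -- The entry `32 C / c` makes the near-baseline mass at most `cδ/32`; the last entry keeps the
  -- entropy at size `√(cδ/64)` below half of the exponent `c²δn/32`; and `K ≥ 1` gives `K ≤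
  -- K^{1+s}`.
  set K : ℝ := max 1 (max (32 * C / c) (A' / (c ^ 2 / 64))) with hK
  have hK1 : 1 ≤ K := le_max_left _ _
  have hKC : 32 * C / c ≤ K := (le_max_left _ _).trans (le_max_right _ _)
  have hKA : A' / (c ^ 2 / 64) ≤ K := (le_max_right _ _).trans (le_max_right _ _)
  refine ⟨K, by linarith, fun m hm Sn hSn => ?_⟩
  have hlim : Tendsto (fun n : ℕ =>
      ENNReal.ofReal (Real.exp (-(c ^ 2 / 64 * (n : ℝ) ^ (1 - 2 / (2 + r)))))) atTop (𝓝 0) := by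
    rw [← ENNReal.ofReal_zero]
    refine (ENNReal.continuous_ofReal.tendsto _).comp
      (Real.tendsto_exp_neg_atTop_nhds_zero.comp (Tendsto.const_mul_atTop (by positivity) ?_))
    -- The exponent equals `r/(2+r)`, which is positive only because `r > 0`.
    refine (tendsto_rpow_atTop ?_).comp tendsto_natCast_atTop_atTop
    rw [sub_pos, div_lt_one (by linarith)]
    linarith
  refine tendsto_of_tendsto_of_tendsto_of_le_of_le' tendsto_const_nhds hlim
    (Eventually.of_forall fun n => zero_le) ?_
  filter_upwards [hm.eventually ht, hm.eventually hC, hm.eventually (eventually_gt_atTop 0),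
    eventually_gt_atTop 0] with n h1 h2 h3 h4
  have hn : (0 : ℝ) < n := by exact_mod_cast h4
  set δ : ℝ := K * max ((n : ℝ) ^ (-(2 / (2 + r)))) ((m n : ℝ) ^ (-(1 / (2 * p)))) with hδ
  have hδn : K * (n : ℝ) ^ (-(2 / (2 + r))) ≤ δ :=
    mul_le_mul_of_nonneg_left (le_max_left _ _) (by linarith)
  have hδm : K * (m n : ℝ) ^ (-(1 / (2 * p))) ≤ δ :=
    mul_le_mul_of_nonneg_left (le_max_right _ _) (by linarith)
  have hδ0 : 0 < δ := lt_of_lt_of_le (by positivity) hδn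
  -- Distances never exceed 1; discarding `δ ≥ 1` keeps the bracket size in the range of the entropy
  -- bound.
  rcases le_or_gt 1 δ with hδ1 | hδ1
  · have hempty : {ω | δ < distF F (Sn n ω) (baseline μ τ₀)} = ∅ := by
      refine Set.eq_empty_of_forall_notMem fun ω hω => ?_
      have hω' : δ < distF F (Sn n ω) (baseline μ τ₀) := hω
      have : distF F (Sn n ω) (baseline μ τ₀) ≤ 1 := measureReal_le_one
      linarith
    rw [hempty, measure_empty]
    exact zero_le
  have ha0 : 0 < c * δ / 64 := by positivity
  have ha1 : c * δ / 64 ≤ 1 := by nlinarith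
  have hent := hA (√(c * δ / 64)) (Real.sqrt_pos.2 ha0) (Real.sqrt_le_one.2 ha1)
  obtain ⟨k, hk, hcov⟩ := exists_coveredBySetBrackets_of_entropy_le ha0.le hent
  have hnear : F.real (nearBaseline μ τ₀ t (m n)) ≤ c * δ / 32 := by
    refine h2.trans ?_
    have hle : C ≤ K * c / 32 := by
      have := (div_le_iff₀ hc0).1 hKC
      linarith
    calc C * (m n : ℝ) ^ (-(1 / (2 * p))) ≤ K * c / 32 * (m n : ℝ) ^ (-(1 / (2 * p))) := by gcongr
      _ = c * (K * (m n : ℝ) ^ (-(1 / (2 * p)))) / 32 := by ring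
      _ ≤ c * δ / 32 := by gcongr
  refine (h.measure_lt_distF_le hμ hγ₁ hγ₂ h3 h4 hδ0 h1.1 h1.2 hnear hcov
    (fun ω => (hSn n ω).1) (fun ω => (hSn n ω).2 hS₀)).trans (ENNReal.ofReal_le_ofReal ?_)
  have hexp : A * √(c * δ / 64) ^ (-r) ≤ c ^ 2 / 64 * δ * n := by
    calc A * √(c * δ / 64) ^ (-r) ≤ |A| * √(c * δ / 64) ^ (-r) := by
          gcongr; exact le_abs_self A
      _ = A' * δ ^ (-(r / 2)) := by
          rw [Real.sqrt_eq_rpow, ← Real.rpow_mul ha0.le, show c * δ / 64 = c / 64 * δ by ring,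
            Real.mul_rpow (by positivity) hδ0.le, hA', show 1 / 2 * -r = -(r / 2) by ring]
          ring
      _ ≤ c ^ 2 / 64 * δ * n :=
          mul_rpow_neg_le_of_rate_le h4 (by positivity) (by field_simp) (by positivity) hK1 hKA hδn
  have hpow : (n : ℝ) ^ (1 - 2 / (2 + r)) ≤ δ * n := by
    rw [sub_eq_neg_add, Real.rpow_add hn, Real.rpow_one]
    refine mul_le_mul_of_nonneg_right (le_trans ?_ hδn) hn.le
    exact le_mul_of_one_le_left (by positivity) hK1
  calc k * Real.exp (-(c ^ 2 / 32 * δ * n))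
      ≤ Real.exp (c ^ 2 / 64 * δ * n) * Real.exp (-(c ^ 2 / 32 * δ * n)) := by
        gcongr
        exact hk.trans (Real.exp_le_exp.2 hexp)
    _ = Real.exp (-(c ^ 2 / 64 * (δ * n))) := by rw [← Real.exp_add]; ring_nf
    _ ≤ Real.exp (-(c ^ 2 / 64 * (n : ℝ) ^ (1 - 2 / (2 + r)))) := by gcongr

end Main

end BaselineSet

theorem mainTheorem11 {d : ℕ} {Ω : Type*} [MeasurableSpace Ω]
    (P : Measure Ω) [IsProbabilityMeasure P]
    (F : Measure (BaselineSet.Cube d)) [IsProbabilityMeasure F]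
    (ν : Measure ℝ) [IsProbabilityMeasure ν]
    (X : ℕ → Ω → BaselineSet.Cube d) (ε : ℕ → ℕ → Ω → ℝ)
    (hdesign : BaselineSet.IsDoseResponseDesign P F ν X ε)
    (μ : BaselineSet.Cube d → ℝ) (hμ : Continuous μ)
    (τ₀ : ℝ) (hτ₀ : ∀ x, τ₀ ≤ μ x)
    (γ : ℝ) (hγ₁ : 1 / 2 < γ) (hγ₂ : γ < 1)
    (𝒮 : Set (Set (BaselineSet.Cube d))) (h𝒮 : ∀ S ∈ 𝒮, MeasurableSet S)
    (hS₀ : BaselineSet.baseline μ τ₀ ∈ 𝒮)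
    (hmin : BaselineSet.IsUniqueMinimizer F γ 𝒮 (BaselineSet.baseline μ τ₀)) :
    -- consistency
    ((∀ u : ℝ, 0 < u → BaselineSet.bracketingEntropy F (BaselineSet.indicators 𝒮) u < ⊤) →
      ∀ m : ℕ → ℕ, Tendsto m atTop atTop →
      ∀ Sn : ℕ → Ω → Set (BaselineSet.Cube d),
        BaselineSet.IsArgminEstimator μ τ₀ γ X ε m 𝒮 Sn →
        ∀ δ : ℝ, 0 < δ →
          Tendsto
            (fun n : ℕ => P {ω | δ < BaselineSet.distF F (Sn n ω) (BaselineSet.baseline μ τ₀)})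
            atTop (𝓝 0)) ∧
    -- rate of convergence
    (∀ p : ℝ, 0 < p → BaselineSet.PRegular μ τ₀ p →
      (∃ c : ℝ, 0 < c ∧ ∀ δ : ℝ, 0 < δ →
        F.real (Metric.thickening δ (BaselineSet.baseline μ τ₀) \
          BaselineSet.thinning δ (BaselineSet.baseline μ τ₀)) ≤ c * δ) →
      ∀ r : ℝ, r < 2 →
      (∃ A : ℝ, ∀ u : ℝ, 0 < u → u ≤ 1 →
        BaselineSet.bracketingEntropy F (BaselineSet.indicators 𝒮) u ≤
          ((A * u ^ (-r) : ℝ) : EReal)) →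
      ∃ K₁ : ℝ, 0 < K₁ ∧
        ∀ m : ℕ → ℕ, Tendsto m atTop atTop →
        ∀ Sn : ℕ → Ω → Set (BaselineSet.Cube d),
          BaselineSet.IsArgminEstimator μ τ₀ γ X ε m 𝒮 Sn →
          Tendsto
            (fun n : ℕ => P {ω | K₁ * max ((n : ℝ) ^ (-(2 / (2 + r)))) ((m n : ℝ) ^ (-(1 / (2 * p))))
              < BaselineSet.distF F (Sn n ω) (BaselineSet.baseline μ τ₀)})
            atTop (𝓝 0)) := by
  refine ⟨fun hent m hm Sn hSn δ hδ =>
    hdesign.tendsto_measure_lt_distF hμ hτ₀ hγ₁ hγ₂ hS₀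
      (fun a ha => BaselineSet.exists_coveredBySetBrackets_of_entropy_lt_top ha.le
        (hent _ (Real.sqrt_pos.2 ha))) hm hSn hδ, ?_⟩
  rintro p hp hreg ⟨c, -, hc⟩ r - ⟨A, hA⟩
  -- For `r ≤ 0` and `u ≤ 1` the entropy is at most `|A|`, so the bracketing numbers are uniformly
  -- bounded.
  rcases lt_or_ge 0 r with hr | hr
  · exact hdesign.exists_rate hμ hτ₀ hγ₁ hγ₂ hS₀ hp hreg hc hr hA
  refine ⟨1, one_pos, fun m hm Sn hSn => ?_⟩
  have hcov : ∀ a : ℝ, 0 < a → a ≤ 1 →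
      ∃ k ≤ ⌊Real.exp |A|⌋₊, BaselineSet.CoveredBySetBrackets F 𝒮 a k := fun a ha ha1 => by
    obtain ⟨k, hk, hkcov⟩ := BaselineSet.exists_coveredBySetBrackets_of_entropy_le ha.le
      (hA (√a) (Real.sqrt_pos.2 ha) (Real.sqrt_le_one.2 ha1))
    refine ⟨k, Nat.le_floor (hk.trans (Real.exp_le_exp.2 ?_)), hkcov⟩
    calc A * √a ^ (-r) ≤ |A| * √a ^ (-r) := by gcongr; exact le_abs_self A
      _ ≤ |A| * 1 := by
        gcongr
        exact Real.rpow_le_one (Real.sqrt_nonneg a) (Real.sqrt_le_one.2 ha1) (by linarith)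
      _ = |A| := mul_one _
  refine tendsto_of_tendsto_of_tendsto_of_le_of_le tendsto_const_nhds
    (hdesign.tendsto_measure_distF_pos hμ hτ₀ hγ₁ hγ₂ hS₀ hcov hm hSn) (fun n => zero_le)
    fun n => measure_mono fun ω hω => ?_
  -- The distance vanishes with probability tending to one, so any nonnegative threshold works, in
  -- particular with `K₁ = 1`.
  refine lt_of_le_of_lt ?_ (show _ < BaselineSet.distF F (Sn n ω) _ from hω)
  positivity
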